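/- Let $I_0(y)=\sum_{n\ge 0}\frac{(y/2)^{2n}}{(n!)^2}$ be the modified Bessel function of order $0$, let $\chi^*_{[-1,1]}$ be the normalized characteristic function of $[-1,1]$ (equal to $1$ on $(-1,1)$, to $1/2$ at $\pm1$ and to $0$ elsewhere), and let \[ \ell_c(t)=\frac{c}{\sinh c}\,\frac{\sin\sqrt{t^2-c^2}}{\sqrt{t^2-c^2}}\quad(t\in\mathbb C) \] be the (entire) Logan function. For $c>0$ and $\varepsilon>0$ put \[ \eta_c(y)=\chi^*_{[-1,1]}(y)\,\frac{c}{2\sinh c}\,I_0\bigl(c\sqrt{1-y^2}\bigr),\qquad \eta_{c,\varepsilon}(y)=\frac1\varepsilon\,\eta_c(y/\varepsilon),\qquad \lambda_{c,\varepsilon}=\ell_c(i\varepsilon/2), \] let $\mu_{c,\varepsilon}$ be the odd function with $\mu_{c,\varepsilon}(t)=-\int_{-\infty}^t\eta_{c,\varepsilon}(\tau)\,d\tau$ for $t<0$, $\mu_{c,\varepsilon}(0)=0$ and $\mu_{c,\varepsilon}(t)=-\mu_{c,\varepsilon}(-t)$ for $t>0$, let $\nu_{c,\varepsilon}(t)=\int_{-\infty}^t\mu_{c,\varepsilon}(\tau)\,d\tau$,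 and write $\mu_c=\mu_{c,1}$, $\nu_c=\nu_{c,1}$. Finally let \[ M_{x,c,\varepsilon}(t)=\lambda_{c,\varepsilon}^{-1}\Bigl[\mu_{c,\varepsilon}\bigl(\log\tfrac tx\bigr)+\Bigl(\frac1{\log t}-\frac12\Bigr)\Bigl(\mu_{c,\varepsilon}\bigl(\log\tfrac tx\bigr)\log\tfrac tx-\nu_{c,\varepsilon}\bigl(\log\tfrac tx\bigr)\Bigr)\Bigr]. \] Let $x\ge100$, $0<\varepsilon\le0.01$, $c\ge1$ and $\alpha\in(0,1)$ be real numbers such that \[ B:=\frac{\varepsilon\,x\,e^{-\varepsilon}\,|\nu_c(\alpha)|}{2\mu_c(\alpha)}>1, \] and let $I_\alpha^+=[e^{\alpha\varepsilon}x,\,e^{\varepsilon}x]$ and $I_\alpha^-=[e^{-\varepsilon}x,\,e^{-\alpha\varepsilon}x]$. Then, for each of the two intervals $I=I_\alpha^+$ and $I=I_\alpha^-$, the sum over all prime powers $p^m\in I$ ($p$ prime, $m\ge1$) satisfies \[ \Bigl|\sum_{p^m\in I}\frac1m\,M_{x,c,\varepsilon}(p^m)\Bigr|\le\frac{2\,\varepsilon\,x\,e^{2\varepsilon}\,|\nu_c(\alpha)|}{\log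 B}+e^{\varepsilon}\mu_c(\alpha)\bigl(4.01\,\varepsilon\sqrt x+\log\log(2x^2)\bigr). \] -/

import Mathlib

open MeasureTheory

noncomputable section

namespace LoganSieve

open Classical in
/-- The normalized characteristic function of a set `A` of real numbers: `1` on the interior of
`A`, `1/2` on the boundary of `A`, and `0` off the closure of `A`. -/
def chiStar (A : Set ℝ) (t : ℝ) : ℝ :=
  if t ∈ interior A then 1 else if t ∈ frontier A then 1 / 2 else 0

/-- The modified Bessel function of the first kind of order `0`. -/
def besselI0 (y : ℝ) : ℝ :=
  ∑' n : ℕ, (y / 2) ^ (2 * n) / ((n.factorial : ℝ) ^ 2)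

/-- The entire function `w ↦ sin w / w`. -/
def csinc (w : ℂ) : ℂ := if w = 0 then 1 else Complex.sin w / w

/-- The Logan function `ℓ_c`, an entire function; the choice of the square root is irrelevant,
since `csinc` is even. -/
def logan (c : ℝ) (t : ℂ) : ℂ :=
  ((c / Real.sinh c : ℝ) : ℂ) * csinc ((t ^ 2 - (c : ℂ) ^ 2) ^ (1 / 2 : ℂ))

/-- The dilated Logan function `ℓ_{c,ε}(t) = ℓ_c(ε t)`. -/
def loganEps (c ε : ℝ) (t : ℂ) : ℂ := logan c ((ε : ℂ) * t)

/-- The inverse Fourier transform `η_c` of the Logan function. -/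
def eta (c y : ℝ) : ℝ :=
  chiStar (Set.Icc (-1) 1) y * (c / (2 * Real.sinh c)) * besselI0 (c * √(1 - y ^ 2))

/-- The dilated kernel `η_{c,ε}(y) = ε⁻¹ η_c(y / ε)`. -/
def etaEps (c ε y : ℝ) : ℝ := 1 / ε * eta c (y / ε)

/-- The number `λ_{c,ε} = ℓ_{c,ε}(i / 2)`, which is real (see `lam_eq`). -/
def lam (c ε : ℝ) : ℝ := (loganEps c ε (Complex.I / 2)).re

/-- The function `μ_{c,ε}`, odd by definition. -/
def muEps (c ε t : ℝ) : ℝ :=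
  if t < 0 then -∫ τ in Set.Iic t, etaEps c ε τ
  else if 0 < t then ∫ τ in Set.Iic (-t), etaEps c ε τ
  else 0

/-- The function `ν_{c,ε}`. -/
def nuEps (c ε t : ℝ) : ℝ := ∫ τ in Set.Iic t, muEps c ε τ

/-- `μ_c = μ_{c,1}`. -/
def mu (c t : ℝ) : ℝ := muEps c 1 t

/-- `ν_c = ν_{c,1}`. -/
def nu (c t : ℝ) : ℝ := nuEps c 1 t

/-- The weight `M_{x,c,ε}(t)`. -/
def weightM (x c ε t : ℝ) : ℝ :=
  (lam c ε)⁻¹ *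
    (muEps c ε (Real.log (t / x)) +
      (1 / Real.log t - 1 / 2) *
        (muEps c ε (Real.log (t / x)) * Real.log (t / x) - nuEps c ε (Real.log (t / x))))

/-- The pairs `(p, m)` with `p` prime, `m ≥ 1` and `p ^ m ∈ I`. -/
def primePowerPairs (I : Set ℝ) : Set (ℕ × ℕ) :=
  {q | q.1.Prime ∧ 1 ≤ q.2 ∧ (q.1 : ℝ) ^ q.2 ∈ I}

/-- The sum of `F(p ^ m) / m` over the prime powers `p ^ m ∈ I`, for a bounded set `I` (so that
the sum is finite, see `primePowerPairs_finite`). -/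
def primePowerSum (I : Set ℝ) (F : ℝ → ℝ) : ℝ :=
  ∑ᶠ q ∈ primePowerPairs I, 1 / (q.2 : ℝ) * F ((q.1 : ℝ) ^ q.2)

/-- The outer interval `I_α⁺`. -/
def outerPlus (x ε α : ℝ) : Set ℝ :=
  Set.Icc (Real.exp (α * ε) * x) (Real.exp ε * x)

/-- The outer interval `I_α⁻`. -/
def outerMinus (x ε α : ℝ) : Set ℝ :=
  Set.Icc (Real.exp (-ε) * x) (Real.exp (-(α * ε)) * x)

/-- The quantity `B`. -/
def sieveB (x c ε α : ℝ) : ℝ :=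
  ε * x * Real.exp (-ε) * |nu c α| / (2 * mu c α)

theorem primePowerPairs_finite {I : Set ℝ} (hI : BddAbove I) : (primePowerPairs I).Finite := by
  obtain ⟨b, hb⟩ := hI
  obtain ⟨N, hN⟩ := exists_nat_ge b
  refine ((Set.finite_Iic N).prod (Set.finite_Iic N)).subset ?_
  rintro ⟨p, m⟩ ⟨hp, hm, hpm⟩
  have h1 : p ^ m ≤ N := by
    have := (hb hpm).trans hN
    exact_mod_cast this
  exact ⟨(Nat.le_self_pow (by simp at hm; lia) p).trans h1, (Nat.lt_pow_self hp.one_lt).le.trans h1⟩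

theorem logan_half_I (c ε : ℝ) (hc : c ≠ 0) :
    loganEps c ε (Complex.I / 2) =
      ((c / Real.sinh c * (Real.sinh (√(c ^ 2 + ε ^ 2 / 4)) / √(c ^ 2 + ε ^ 2 / 4)) : ℝ) : ℂ) := by
  have hs : 0 < c ^ 2 + ε ^ 2 / 4 := by positivity
  set s := √(c ^ 2 + ε ^ 2 / 4) with hsdef
  have hs0 : 0 < s := Real.sqrt_pos.2 hs
  have hsq : s ^ 2 = c ^ 2 + ε ^ 2 / 4 := Real.sq_sqrt hs.le
  have hw : (((ε : ℂ) * (Complex.I / 2)) ^ 2 - (c : ℂ) ^ 2) = ((s : ℂ) * Complex.I) ^ 2 := by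
    have h2 : (s : ℂ) ^ 2 = (c : ℂ) ^ 2 + (ε : ℂ) ^ 2 / 4 := by exact_mod_cast hsq
    rw [mul_pow, mul_pow, div_pow, h2, Complex.I_sq]
    ring
  have hroot : (((s : ℂ) * Complex.I) ^ 2) ^ (1 / 2 : ℂ) = (s : ℂ) * Complex.I := by
    have harg : ((s : ℂ) * Complex.I).arg = Real.pi / 2 := by
      rw [Complex.arg_real_mul _ hs0, Complex.arg_I]
    have := Complex.pow_cpow_nat_inv (x := (s : ℂ) * Complex.I) (n := 2) two_ne_zero
      (by rw [harg]; norm_num; linarith [Real.pi_pos]) (by rw [harg]; norm_num)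
    simpa [one_div] using this
  have hsC : (s : ℂ) ≠ 0 := by exact_mod_cast hs0.ne'
  have hne : (s : ℂ) * Complex.I ≠ 0 := mul_ne_zero hsC Complex.I_ne_zero
  rw [loganEps, logan, hw, hroot, csinc, if_neg hne, Complex.sin_mul_I, mul_comm (s : ℂ),
    mul_comm (Complex.sinh _), mul_div_mul_left _ _ Complex.I_ne_zero]
  push_cast
  rfl

theorem lam_eq (c ε : ℝ) (hc : c ≠ 0) : ((lam c ε : ℝ) : ℂ) = loganEps c ε (Complex.I / 2) := by
  rw [lam, logan_half_I c ε hc, Complex.ofReal_re]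

end LoganSieve

end

/-!
Parametrise the two intervals by `t = x * exp (δ * u)` with `δ = ±ε` and `α ≤ u ≤ 1`. There
`|weightM x c ε t| ≤ exp ε * mu c u`, and `mu c` is nonnegative and decreasing for `u > 0`, so the
weight is at most `mu c α`, monotone in `t`, and has integral at most `ε * x * exp ε * |nu c α|`.
Primes larger than `3` are coprime to `6`, so Selberg's sieve by the primes from `5` on, applied to
the residues `1` and `5` modulo `6`, bounds the weighted sum over primes; monotonicity keeps each
progression within `mu c α` of its integral, and a level `z` of order `√(sieveB x c ε α)` balances
the two terms. For a fixed exponent `m ≥ 2`, Bernoulli's inequality bounds the length of the range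
of `p` by `O(ε * √x / m)`, so the terms `1 / m` sum to the square-root term plus a harmonic sum
over `m ≤ log (2 * x ^ 2)`.
-/

noncomputable section

namespace LoganSieve

section SelbergSieve

open Finset BoundingSieve
open scoped ArithmeticFunction.Moebius

theorem sum_moebius_multiples_of_dvd {l n : ℕ} (hn : Squarefree n) (hl : l ∣ n) :
    ∑ d ∈ n.divisors with l ∣ d, μ d = if n = l then μ l else 0 := by
  obtain ⟨k, rfl⟩ := hl
  have hcop : l.Coprime k := Nat.coprime_of_squarefree_mul hn
  obtain ⟨hl0, hk0⟩ : l ≠ 0 ∧ k ≠ 0 := mul_ne_zero_iff.1 hn.ne_zero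
  have himage : {d ∈ (l * k).divisors | l ∣ d} = k.divisors.image (l * ·) := by
    ext d
    simp only [mem_filter, Nat.mem_divisors, mem_image]
    constructor
    · rintro ⟨⟨hdvd, -⟩, e, rfl⟩
      exact ⟨e, ⟨(mul_dvd_mul_iff_left hl0).1 hdvd, hk0⟩, rfl⟩
    · rintro ⟨e, ⟨he, -⟩, rfl⟩
      exact ⟨⟨mul_dvd_mul_left l he, hn.ne_zero⟩, dvd_mul_right l e⟩
  calc ∑ d ∈ (l * k).divisors with l ∣ d, μ d = ∑ e ∈ k.divisors, μ (l * e) := by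
        rw [himage, sum_image fun a _ b _ h => mul_left_cancel₀ hl0 h]
    _ = μ l * ∑ e ∈ k.divisors, μ e := by
        rw [mul_sum]
        exact sum_congr rfl fun e he =>
          ArithmeticFunction.isMultiplicative_moebius.map_mul_of_coprime
            (hcop.coprime_dvd_right (Nat.dvd_of_mem_divisors he))
    _ = if l * k = l then μ l else 0 := by
        rw [← ArithmeticFunction.coe_mul_zeta_apply, ArithmeticFunction.moebius_mul_coe_zeta,
          ArithmeticFunction.one_apply]
        simp [hl0]

theorem sum_abs_lambdaSquared_le (w : ℕ → ℝ) (n : ℕ) :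
    ∑ d ∈ n.divisors, |lambdaSquared w d| ≤ (∑ d ∈ n.divisors, |w d|) ^ 2 := by
  have hterm : ∀ d ∈ n.divisors, |lambdaSquared w d| ≤
      ∑ a ∈ n.divisors, ∑ b ∈ n.divisors, if d = a.lcm b then |w a| * |w b| else 0 := by
    intro d hd
    have hsub : d.divisors ⊆ n.divisors := Nat.divisors_subset_of_dvd
      (Nat.ne_zero_of_mem_divisors hd) (Nat.dvd_of_mem_divisors hd)
    have hnonneg : ∀ a b, 0 ≤ if d = a.lcm b then |w a| * |w b| else 0 := fun a b => by
      split_ifs <;> positivity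
    calc |lambdaSquared w d|
        ≤ ∑ a ∈ d.divisors, ∑ b ∈ d.divisors, |if d = a.lcm b then w a * w b else 0| :=
          (abs_sum_le_sum_abs _ _).trans (sum_le_sum fun a _ => abs_sum_le_sum_abs _ _)
      _ = ∑ a ∈ d.divisors, ∑ b ∈ d.divisors, if d = a.lcm b then |w a| * |w b| else 0 := by
          simp_rw [apply_ite abs, abs_mul, abs_zero]
      _ ≤ ∑ a ∈ d.divisors, ∑ b ∈ n.divisors, if d = a.lcm b then |w a| * |w b| else 0 :=
          sum_le_sum fun a _ => sum_le_sum_of_subset_of_nonneg hsub fun b _ _ => hnonneg a b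
      _ ≤ _ := sum_le_sum_of_subset_of_nonneg hsub fun a _ _ => sum_nonneg fun b _ => hnonneg a b
  calc ∑ d ∈ n.divisors, |lambdaSquared w d|
      ≤ ∑ d ∈ n.divisors, ∑ a ∈ n.divisors, ∑ b ∈ n.divisors,
          if d = a.lcm b then |w a| * |w b| else 0 := sum_le_sum hterm
    _ = ∑ a ∈ n.divisors, ∑ b ∈ n.divisors, ∑ d ∈ n.divisors,
          if d = a.lcm b then |w a| * |w b| else 0 := by
        rw [sum_comm, sum_congr rfl fun a _ => sum_comm]
    _ ≤ ∑ a ∈ n.divisors, ∑ b ∈ n.divisors, |w a| * |w b| := by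
        refine sum_le_sum fun a _ => sum_le_sum fun b _ => ?_
        rw [sum_ite_eq']
        split_ifs
        exacts [le_rfl, by positivity]
    _ = (∑ d ∈ n.divisors, |w d|) ^ 2 := by rw [sq, sum_mul_sum]

/-- The sum `∑ g(l)` of the Selberg terms over the support `D` of the sieve weights. -/
def selbergSum (s : BoundingSieve) (D : Finset ℕ) : ℝ := ∑ l ∈ D, s.selbergTerms l

/-- The sum `∑ g(l) ∑_{d ∣ l} ν(d)⁻¹`, which controls the `ℓ¹` norm of the Selberg weights and
hence the error term of the sieve. -/
def sigmaSum (s : BoundingSieve) (D : Finset ℕ) : ℝ :=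
  ∑ l ∈ D, s.selbergTerms l * ∑ d ∈ l.divisors, (s.nu d)⁻¹

/-- The Selberg weights supported on a divisor-closed set `D` of divisors of the sifting product:
the choice of `Λ²` weights that minimizes the main term. -/
def selbergWeight (s : BoundingSieve) (D : Finset ℕ) (d : ℕ) : ℝ :=
  μ d / s.nu d * (∑ l ∈ D with d ∣ l, s.selbergTerms l) / selbergSum s D

variable {s : BoundingSieve} {D : Finset ℕ}

theorem selbergSum_pos (hD : D ⊆ s.prodPrimes.divisors) (hD1 : 1 ∈ D) : 0 < selbergSum s D :=
  sum_pos (fun _ hl => selbergTerms_pos (Nat.dvd_of_mem_divisors (hD hl))) ⟨1, hD1⟩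

theorem selbergWeight_one (hD : D ⊆ s.prodPrimes.divisors) (hD1 : 1 ∈ D) :
    selbergWeight s D 1 = 1 := by
  simp only [selbergWeight, ArithmeticFunction.moebius_apply_one, s.nu_mult.map_one, one_dvd,
    filter_true, Int.cast_one, div_one, one_mul]
  exact div_self (selbergSum_pos hD hD1).ne'

theorem mem_divisors_of_dvd {n l d : ℕ} (hD : D ⊆ n.divisors) (hl : l ∈ D) (hd : d ∣ l) :
    d ∈ l.divisors :=
  Nat.mem_divisors.2 ⟨hd, (Nat.pos_of_mem_divisors (hD hl)).ne'⟩

theorem selbergWeight_of_notMem (hD : D ⊆ s.prodPrimes.divisors)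
    (hdvd : ∀ l ∈ D, l.divisors ⊆ D) {d : ℕ} (hd : d ∉ D) : selbergWeight s D d = 0 := by
  have hempty : {l ∈ D | d ∣ l} = ∅ := filter_eq_empty_iff.2 fun l hl hdl =>
    hd (hdvd l hl (mem_divisors_of_dvd hD hl hdl))
  rw [selbergWeight, hempty, sum_empty, mul_zero, zero_div]

theorem sum_nu_mul_selbergWeight (hD : D ⊆ s.prodPrimes.divisors)
    (hdvd : ∀ l ∈ D, l.divisors ⊆ D) {l : ℕ} (hl : l ∈ D) :
    ∑ d ∈ D with l ∣ d, s.nu d * selbergWeight s D d =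
      μ l * s.selbergTerms l / selbergSum s D := by
  have hweight : ∀ d ∈ D, s.nu d * selbergWeight s D d =
      (∑ n ∈ D with d ∣ n, μ d * s.selbergTerms n) / selbergSum s D := by
    intro d hd
    have := nu_ne_zero (Nat.dvd_of_mem_divisors (hD hd))
    rw [selbergWeight, ← mul_sum]
    field_simp
  have hinner : ∀ n ∈ D, ∑ d ∈ n.divisors with l ∣ d, (μ d : ℝ) * s.selbergTerms n =
      if n = l then μ l * s.selbergTerms l else 0 := by
    intro n hn
    rw [← sum_mul, ← Int.cast_sum]
    by_cases hln : l ∣ n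
    · rw [sum_moebius_multiples_of_dvd (squarefree_of_mem_divisors_prodPrimes (hD hn)) hln]
      split_ifs with h <;> simp [h]
    · have hempty : {d ∈ n.divisors | l ∣ d} = ∅ := filter_eq_empty_iff.2 fun d hd hld =>
        hln (hld.trans (Nat.dvd_of_mem_divisors hd))
      have hne : n ≠ l := fun h => hln h.symm.dvd
      rw [hempty, sum_empty, Int.cast_zero, zero_mul, if_neg hne]
  rw [sum_congr rfl fun d hd => hweight d (mem_filter.1 hd).1, ← sum_div]
  congr 1
  calc ∑ d ∈ D with l ∣ d, ∑ n ∈ D with d ∣ n, (μ d : ℝ) * s.selbergTerms n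
      = ∑ n ∈ D, ∑ d ∈ n.divisors with l ∣ d, (μ d : ℝ) * s.selbergTerms n := by
        refine sum_comm' fun d n => ?_
        simp only [mem_filter]
        exact ⟨fun h => ⟨⟨mem_divisors_of_dvd hD h.2.1 h.2.2, h.1.2⟩, h.2.1⟩,
          fun h => ⟨⟨hdvd n h.2 h.1.1, h.1.2⟩, h.2, Nat.dvd_of_mem_divisors h.1.1⟩⟩
    _ = μ l * s.selbergTerms l := by
        rw [sum_congr rfl hinner, sum_ite_eq', if_pos hl]

theorem mainSum_lambdaSquared_selbergWeight (hD : D ⊆ s.prodPrimes.divisors)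
    (hdvd : ∀ l ∈ D, l.divisors ⊆ D) (hD1 : 1 ∈ D) :
    s.mainSum (lambdaSquared (selbergWeight s D)) = 1 / selbergSum s D := by
  have hS := (selbergSum_pos hD hD1).ne'
  have hzero : ∀ d ∈ s.prodPrimes.divisors, d ∉ D → selbergWeight s D d = 0 :=
    fun d _ hd => selbergWeight_of_notMem hD hdvd hd
  have hinner : ∀ l, ∑ d ∈ s.prodPrimes.divisors,
      (if l ∣ d then s.nu d * selbergWeight s D d else 0) =
        ∑ d ∈ D with l ∣ d, s.nu d * selbergWeight s D d := fun l => by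
    rw [sum_filter]
    exact (sum_subset hD fun d hd hdD => by rw [hzero d hd hdD, mul_zero, ite_self]).symm
  have houter : ∀ l ∈ s.prodPrimes.divisors, l ∉ D →
      ∑ d ∈ D with l ∣ d, s.nu d * selbergWeight s D d = 0 := fun l _ hl =>
    sum_eq_zero fun d hd => (hl (hdvd d (mem_filter.1 hd).1
      (mem_divisors_of_dvd hD (mem_filter.1 hd).1 (mem_filter.1 hd).2))).elim
  calc s.mainSum (lambdaSquared (selbergWeight s D))
      = ∑ l ∈ s.prodPrimes.divisors, (s.selbergTerms l)⁻¹ *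
          (∑ d ∈ D with l ∣ d, s.nu d * selbergWeight s D d) ^ 2 := by
        simp_rw [mainSum_lambdaSquared_eq_sum_mul_sum_sq, hinner]
    _ = ∑ l ∈ D, (s.selbergTerms l)⁻¹ *
          (∑ d ∈ D with l ∣ d, s.nu d * selbergWeight s D d) ^ 2 :=
        (sum_subset hD fun l hl hlD => by rw [houter l hl hlD]; ring).symm
    _ = ∑ l ∈ D, s.selbergTerms l / selbergSum s D ^ 2 := by
        refine sum_congr rfl fun l hl => ?_
        have hg := (selbergTerms_pos (Nat.dvd_of_mem_divisors (hD hl))).ne'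
        have hμ : (μ l : ℝ) ^ 2 = 1 := by
          exact_mod_cast ArithmeticFunction.moebius_sq_eq_one_of_squarefree
            (squarefree_of_mem_divisors_prodPrimes (hD hl))
        rw [sum_nu_mul_selbergWeight hD hdvd hl, div_pow, mul_pow, hμ]
        field_simp
    _ = 1 / selbergSum s D := by
        rw [← sum_div, ← selbergSum]
        field_simp

theorem sum_abs_selbergWeight (hD : D ⊆ s.prodPrimes.divisors)
    (hdvd : ∀ l ∈ D, l.divisors ⊆ D) (hD1 : 1 ∈ D) :
    ∑ d ∈ s.prodPrimes.divisors, |selbergWeight s D d| = sigmaSum s D / selbergSum s D := by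
  have hweight : ∀ d ∈ D, |selbergWeight s D d| =
      (∑ n ∈ D with d ∣ n, s.selbergTerms n * (s.nu d)⁻¹) / selbergSum s D := by
    intro d hd
    have hμ : |(μ d : ℝ)| = 1 := by
      exact_mod_cast ArithmeticFunction.abs_moebius_eq_one_of_squarefree
        (squarefree_of_mem_divisors_prodPrimes (hD hd))
    have hsum : 0 ≤ ∑ n ∈ D with d ∣ n, s.selbergTerms n := sum_nonneg fun n hn =>
      (selbergTerms_pos (Nat.dvd_of_mem_divisors (hD (mem_filter.1 hn).1))).le
    rw [selbergWeight, abs_div, abs_mul, abs_div, hμ, abs_of_pos (selbergSum_pos hD hD1),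
      abs_of_pos (nu_pos_of_dvd_prodPrimes (Nat.dvd_of_mem_divisors (hD hd))), abs_of_nonneg hsum,
      ← sum_mul, one_div, mul_comm]
  calc ∑ d ∈ s.prodPrimes.divisors, |selbergWeight s D d|
      = ∑ d ∈ D, |selbergWeight s D d| := (sum_subset hD fun d _ hd => by
        rw [selbergWeight_of_notMem hD hdvd hd, abs_zero]).symm
    _ = (∑ d ∈ D, ∑ n ∈ D with d ∣ n, s.selbergTerms n * (s.nu d)⁻¹) / selbergSum s D := by
        rw [sum_congr rfl hweight, sum_div]
    _ = (∑ n ∈ D, ∑ d ∈ n.divisors, s.selbergTerms n * (s.nu d)⁻¹) / selbergSum s D := by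
        congr 1
        refine sum_comm' fun d n => ?_
        simp only [mem_filter]
        exact ⟨fun h => ⟨mem_divisors_of_dvd hD h.2.1 h.2.2, h.2.1⟩,
          fun h => ⟨hdvd n h.2 h.1, h.2, Nat.dvd_of_mem_divisors h.1⟩⟩
    _ = sigmaSum s D / selbergSum s D := by simp_rw [← mul_sum, sigmaSum]

theorem siftedSum_le_selbergSum_sigmaSum (hD : D ⊆ s.prodPrimes.divisors)
    (hdvd : ∀ l ∈ D, l.divisors ⊆ D) (hD1 : 1 ∈ D) {R : ℝ}
    (hR : ∀ d, d ∣ s.prodPrimes → |s.rem d| ≤ R) :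
    s.siftedSum ≤
      s.totalMass / selbergSum s D + R * (sigmaSum s D / selbergSum s D) ^ 2 := by
  have herr : s.errSum (lambdaSquared (selbergWeight s D)) ≤
      R * (sigmaSum s D / selbergSum s D) ^ 2 := by
    have hR0 : 0 ≤ R := (abs_nonneg _).trans (hR 1 (one_dvd _))
    calc s.errSum (lambdaSquared (selbergWeight s D))
        ≤ ∑ d ∈ s.prodPrimes.divisors, |lambdaSquared (selbergWeight s D) d| * R :=
          sum_le_sum fun d hd =>
            mul_le_mul_of_nonneg_left (hR d (Nat.dvd_of_mem_divisors hd)) (abs_nonneg _)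
      _ = R * ∑ d ∈ s.prodPrimes.divisors, |lambdaSquared (selbergWeight s D) d| := by
          rw [← sum_mul, mul_comm]
      _ ≤ R * (∑ d ∈ s.prodPrimes.divisors, |selbergWeight s D d|) ^ 2 := by
          gcongr
          exact sum_abs_lambdaSquared_le _ _
      _ = R * (sigmaSum s D / selbergSum s D) ^ 2 := by rw [sum_abs_selbergWeight hD hdvd hD1]
  calc s.siftedSum
      ≤ s.totalMass * s.mainSum (lambdaSquared (selbergWeight s D)) +
          s.errSum (lambdaSquared (selbergWeight s D)) :=
        siftedSum_le_mainSum_errSum_of_upperMoebius _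
          (upperMoebius_lambdaSquared _ (selbergWeight_one hD hD1))
    _ ≤ s.totalMass / selbergSum s D + R * (sigmaSum s D / selbergSum s D) ^ 2 := by
        rw [mainSum_lambdaSquared_selbergWeight hD hdvd hD1, mul_one_div]
        gcongr

end SelbergSieve

section SieveByPrimes

open Finset BoundingSieve

/-- The squarefree integers below `z` that are coprime to `k`: the support of the Selberg weights
for the sieve by the primes below `z` that do not divide `k`. -/
def sieveSupport (k z : ℕ) : Finset ℕ := {n ∈ range z | Squarefree n ∧ n.Coprime k}

/-- The primes below `z` that do not divide `k`: the primes sieved by. -/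
def sievePrimes (k z : ℕ) : Finset ℕ := {p ∈ range z | p.Prime ∧ ¬p ∣ k}

/-- The value `∑ 1 / φ(n)` of `selbergSum` for the sieve by the primes below `z` prime to `k`. -/
def totientSum (k z : ℕ) : ℝ := ∑ n ∈ sieveSupport k z, 1 / (n.totient : ℝ)

/-- The value `∑ σ(n) / φ(n)` of `sigmaSum` for the sieve by the primes below `z` prime to `k`. -/
def sigmaTotientSum (k z : ℕ) : ℝ :=
  ∑ n ∈ sieveSupport k z, (∑ d ∈ n.divisors, (d : ℝ)) / (n.totient : ℝ)

/-- The sieve of a weighted finite set `A` of integers by the primes below `z` that do not divide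
`k`, where a proportion `1 / d` of the total mass is expected on the multiples of `d`. -/
def coprimeSieve (k z : ℕ) (A : Finset ℕ) (w : ℕ → ℝ) (hw : ∀ n, 0 ≤ w n) (X : ℝ) :
    BoundingSieve where
  support := A
  prodPrimes := ∏ p ∈ sievePrimes k z, p
  prodPrimes_squarefree := squarefree_prod_of_pairwise_isCoprime
    (fun _ hp _ hq hpq => Nat.coprime_iff_isRelPrime.1
      ((Nat.coprime_primes (mem_filter.1 hp).2.1 (mem_filter.1 hq).2.1).2 hpq))
    (fun _ hp => (mem_filter.1 hp).2.1.prime.squarefree)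
  weights := w
  weights_nonneg := hw
  totalMass := X
  nu := ⟨fun d => (d : ℝ)⁻¹, by simp⟩
  nu_mult := ⟨by simp, fun _ => by simp [mul_comm]⟩
  nu_pos_of_prime p hp _ := by simpa using hp.pos
  nu_lt_one_of_prime p hp _ := inv_lt_one_of_one_lt₀ (by exact_mod_cast hp.one_lt)

theorem totient_eq_mul_prod (n : ℕ) :
    (n.totient : ℝ) = n * ∏ p ∈ n.primeFactors, (1 - (p : ℝ)⁻¹) := by
  simpa using congrArg (Rat.cast : ℚ → ℝ) (Nat.totient_eq_mul_prod_factors n)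

variable {k z : ℕ}

theorem mem_sieveSupport {n : ℕ} :
    n ∈ sieveSupport k z ↔ n < z ∧ Squarefree n ∧ n.Coprime k := by
  simp [sieveSupport]

theorem mem_sievePrimes {p : ℕ} : p ∈ sievePrimes k z ↔ p < z ∧ p.Prime ∧ ¬p ∣ k := by
  simp [sievePrimes]

theorem one_mem_sieveSupport (hz : 1 < z) : 1 ∈ sieveSupport k z := by
  simp [mem_sieveSupport, hz]

theorem divisors_subset_sieveSupport {n : ℕ} (hn : n ∈ sieveSupport k z) :
    n.divisors ⊆ sieveSupport k z := fun d hd => by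
  obtain ⟨hnz, hsq, hcop⟩ := mem_sieveSupport.1 hn
  have hdn := Nat.dvd_of_mem_divisors hd
  exact mem_sieveSupport.2 ⟨(Nat.divisor_le hd).trans_lt hnz, hsq.squarefree_of_dvd hdn,
    hcop.coprime_dvd_left hdn⟩

theorem primeFactors_subset_sievePrimes {n : ℕ} (hn : n ∈ sieveSupport k z) :
    n.primeFactors ⊆ sievePrimes k z := fun p hp => by
  obtain ⟨hnz, -, hcop⟩ := mem_sieveSupport.1 hn
  have hpp := Nat.prime_of_mem_primeFactors hp
  exact mem_sievePrimes.2 ⟨(Nat.le_of_mem_primeFactors hp).trans_lt hnz, hpp,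
    hpp.coprime_iff_not_dvd.1 (hcop.coprime_dvd_left (Nat.dvd_of_mem_primeFactors hp))⟩

theorem prod_sievePrimes_coprime : (∏ p ∈ sievePrimes k z, p).Coprime k :=
  Nat.Coprime.prod_left fun _ hp =>
    (mem_sievePrimes.1 hp).2.1.coprime_iff_not_dvd.2 (mem_sievePrimes.1 hp).2.2

theorem prod_sievePrimes_coprime_prime_of_le {p : ℕ} (hp : p.Prime) (hzp : z ≤ p) :
    (∏ q ∈ sievePrimes k z, q).Coprime p :=
  Nat.Coprime.prod_left fun _ hq => (Nat.coprime_primes (mem_sievePrimes.1 hq).2.1 hp).2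
    ((mem_sievePrimes.1 hq).1.trans_le hzp).ne

section

variable {A : Finset ℕ} {w : ℕ → ℝ} {hw : ∀ n, 0 ≤ w n} {X : ℝ}

theorem sieveSupport_subset_divisors_prodPrimes :
    sieveSupport k z ⊆ (coprimeSieve k z A w hw X).prodPrimes.divisors := fun n hn => by
  refine Nat.mem_divisors.2 ⟨?_, prodPrimes_ne_zero⟩
  rw [← Nat.prod_primeFactors_of_squarefree (mem_sieveSupport.1 hn).2.1]
  exact prod_dvd_prod_of_subset _ (sievePrimes k z) _ (primeFactors_subset_sievePrimes hn)

theorem selbergTerms_coprimeSieve (n : ℕ) :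
    (coprimeSieve k z A w hw X).selbergTerms n = 1 / (n.totient : ℝ) := by
  rw [selbergTerms_apply, totient_eq_mul_prod, one_div, mul_inv, prod_inv_distrib]
  rfl

end

theorem totientSum_pos (hz : 1 < z) : 0 < totientSum k z :=
  sum_pos (fun n hn => by
    have := Nat.totient_pos.2 (mem_sieveSupport.1 hn).2.1.ne_zero.bot_lt
    positivity) ⟨1, one_mem_sieveSupport hz⟩

theorem sum_primes_ge_le_selberg (hz : 1 < z) (A : Finset ℕ) {w : ℕ → ℝ} (hw : ∀ n, 0 ≤ w n)
    {X R : ℝ} (hR : ∀ m : ℕ, 0 < m → m.Coprime k → |∑ n ∈ A with m ∣ n, w n - X / m| ≤ R) :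
    ∑ n ∈ A with n.Prime ∧ z ≤ n, w n ≤
      X / totientSum k z + R * (sigmaTotientSum k z / totientSum k z) ^ 2 := by
  set s := coprimeSieve k z A w hw X with hs
  have hS : selbergSum s (sieveSupport k z) = totientSum k z :=
    sum_congr rfl fun n _ => selbergTerms_coprimeSieve n
  have hσ : sigmaSum s (sieveSupport k z) = sigmaTotientSum k z :=
    sum_congr rfl fun n _ => by
      rw [hs, selbergTerms_coprimeSieve, one_div_mul_eq_div]
      simp [coprimeSieve]
  have hrem : ∀ d, d ∣ s.prodPrimes → |s.rem d| ≤ R := fun d hd => by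
    have := hR d (Nat.pos_of_dvd_of_pos hd prodPrimes_ne_zero.bot_lt)
      (prod_sievePrimes_coprime.coprime_dvd_left hd)
    simpa [hs, coprimeSieve, sum_filter, div_eq_inv_mul] using this
  calc ∑ n ∈ A with n.Prime ∧ z ≤ n, w n
      ≤ ∑ n ∈ A with s.prodPrimes.Coprime n, w n :=
        sum_le_sum_of_subset_of_nonneg (fun n hn => by
          obtain ⟨hnA, hp, hzn⟩ := mem_filter.1 hn
          exact mem_filter.2 ⟨hnA, prod_sievePrimes_coprime_prime_of_le hp hzn⟩) fun n _ _ => hw n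
    _ = s.siftedSum := sum_filter _ _
    _ ≤ _ := by
        rw [← hS, ← hσ]
        exact siftedSum_le_selbergSum_sigmaSum sieveSupport_subset_divisors_prodPrimes
          (fun _ => divisors_subset_sieveSupport) (one_mem_sieveSupport hz) hrem

end SieveByPrimes

section TotientSums

open Finset UniqueFactorizationMonoid

theorem sum_inv_factoredNumbers_le (P : Finset ℕ) {s : Finset ℕ}
    (hs : ∀ m ∈ s, m ∈ Nat.factoredNumbers P) :
    ∑ m ∈ s, (m : ℝ)⁻¹ ≤ ∏ p ∈ P with p.Prime, (1 - (p : ℝ)⁻¹)⁻¹ := by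
  let f : ℕ →* ℝ := (invMonoidWithZeroHom.comp (Nat.castRingHom ℝ).toMonoidWithZeroHom : ℕ →*₀ ℝ)
  have hhas := (EulerProduct.summable_and_hasSum_factoredNumbers_prod_filter_prime_geometric
    (f := f) (fun {p} hp => by
      rw [show f p = (p : ℝ)⁻¹ from rfl, norm_inv, Real.norm_natCast]
      exact inv_lt_one_of_one_lt₀ (by exact_mod_cast hp.one_lt)) P).2
  rw [← sum_subtype_of_mem (p := (· ∈ Nat.factoredNumbers P)) (fun m : ℕ => (m : ℝ)⁻¹) hs]
  exact sum_le_hasSum _ (fun m _ => inv_nonneg.2 (Nat.cast_nonneg m.1)) hhas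

/- The integers with radical `n` are the products `n * l` where `l` has no prime factor outside
those of `n`. -/
theorem sum_inv_le_inv_totient {n : ℕ} {s : Finset ℕ}
    (hs : ∀ m ∈ s, m ≠ 0 ∧ radical m = n) :
    ∑ m ∈ s, 1 / (m : ℝ) ≤ 1 / n.totient := by
  obtain rfl | ⟨m₀, hm₀⟩ := s.eq_empty_or_nonempty
  · simp
  have hn : n ≠ 0 := (hs m₀ hm₀).2 ▸ radical_ne_zero
  have hdvd : ∀ m ∈ s, n * (m / n) = m := fun m hm =>
    Nat.mul_div_cancel' ((hs m hm).2 ▸ radical_dvd_self)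
  have hinj : Set.InjOn (· / n) (s : Set ℕ) := fun a ha b hb hab => by
    rw [← hdvd a ha, ← hdvd b hb, show a / n = b / n from hab]
  have hfactored : ∀ l ∈ s.image (· / n), l ∈ Nat.factoredNumbers n.primeFactors := by
    refine forall_mem_image.2 fun m hm => ?_
    obtain ⟨hm0, hrad⟩ := hs m hm
    refine Nat.mem_factoredNumbers_iff_primeFactors_subset.2
      ⟨right_ne_zero_of_mul (hdvd m hm ▸ hm0), ?_⟩
    rw [← hrad, Nat.primeFactors_radical, hrad]
    exact Nat.primeFactors_mono ⟨n, by rw [mul_comm, hdvd m hm]⟩ hm0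
  calc ∑ m ∈ s, 1 / (m : ℝ) = ∑ m ∈ s, (n : ℝ)⁻¹ * ((m / n : ℕ) : ℝ)⁻¹ :=
        sum_congr rfl fun m hm => by rw [← mul_inv, ← Nat.cast_mul, hdvd m hm, one_div]
    _ = (n : ℝ)⁻¹ * ∑ l ∈ s.image (· / n), (l : ℝ)⁻¹ := by rw [← mul_sum, sum_image hinj]
    _ ≤ (n : ℝ)⁻¹ * ∏ p ∈ n.primeFactors with p.Prime, (1 - (p : ℝ)⁻¹)⁻¹ := by
        gcongr
        exact sum_inv_factoredNumbers_le _ hfactored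
    _ = 1 / n.totient := by
        rw [filter_true_of_mem fun p hp => Nat.prime_of_mem_primeFactors hp, prod_inv_distrib,
          ← mul_inv, ← totient_eq_mul_prod, one_div]

theorem sum_inv_le_totientSum {k z : ℕ} {s : Finset ℕ}
    (hs : ∀ m ∈ s, m ≠ 0 ∧ m < z ∧ m.Coprime k) : ∑ m ∈ s, 1 / (m : ℝ) ≤ totientSum k z := by
  have hmaps : ∀ m ∈ s, radical m ∈ sieveSupport k z := fun m hm => by
    obtain ⟨hm0, hmz, hcop⟩ := hs m hm
    exact mem_sieveSupport.2 ⟨(Nat.radical_le_self_iff.2 hm0).trans_lt hmz, squarefree_radical,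
      hcop.coprime_dvd_left radical_dvd_self⟩
  rw [← sum_fiberwise_of_maps_to hmaps]
  exact sum_le_sum fun n _ => sum_inv_le_inv_totient fun m hm =>
    ⟨(hs m (mem_filter.1 hm).1).1, (mem_filter.1 hm).2⟩

theorem sum_range_coprime_six {M : Type*} [AddCommMonoid M] (f : ℕ → M) (j : ℕ) :
    ∑ m ∈ range (6 * j) with m.Coprime 6, f m = ∑ i ∈ range j, (f (6 * i + 1) + f (6 * i + 5)) := by
  rw [sum_filter]
  induction j with
  | zero => simp
  | succ j ih =>
    rw [mul_add_one, sum_range_add, ih, sum_range_succ _ j]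
    norm_num [sum_range_succ, Nat.coprime_mul_left_add_left]

theorem card_coprime_six (j : ℕ) : #{n ∈ range (6 * j) | n.Coprime 6} = 2 * j := by
  rw [card_eq_sum_ones, sum_range_coprime_six]
  simp [mul_comm]

theorem log_one_add_div_one_sub_le {x : ℝ} (hx : 0 ≤ x) (hx' : x ≤ 1 / 3) :
    Real.log ((1 + x) / (1 - x)) ≤ 18 * x / (9 - 4 * x ^ 2) := by
  have hseries := Real.log_div_le_sum_range_add hx (by linarith) 2
  norm_num [sum_range_succ] at hseries
  have hsq : x ^ 2 ≤ 1 / 9 := by nlinarith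
  have hden : 0 < 1 - x ^ 2 := by linarith
  have hle : x + x ^ 3 / 3 + x ^ 5 / (1 - x ^ 2) ≤ 9 * x / (9 - 4 * x ^ 2) := by
    have heq : x + x ^ 3 / 3 + x ^ 5 / (1 - x ^ 2) =
        x * (3 - 2 * x ^ 2 + 2 * x ^ 4) / (3 * (1 - x ^ 2)) := by
      field_simp
      ring
    have hpoly : 0 ≤ x ^ 3 * (3 - 26 * x ^ 2 + 8 * x ^ 4) :=
      mul_nonneg (pow_nonneg hx 3) (by nlinarith [pow_nonneg hx 4])
    rw [heq, div_le_div_iff₀ (by positivity) (by linarith)]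
    linarith
  have : 18 * x / (9 - 4 * x ^ 2) = 2 * (9 * x / (9 - 4 * x ^ 2)) := by ring
  linarith

theorem log_add_one_sub_log_le {t : ℝ} (ht : 1 ≤ t) :
    Real.log (t + 1) - Real.log t ≤ 3 * (1 / (6 * t + 1) + 1 / (6 * t + 5)) := by
  have hle := log_one_add_div_one_sub_le (x := 1 / (2 * t + 1)) (by positivity)
    (by gcongr; linarith)
  have hquot : (1 + 1 / (2 * t + 1)) / (1 - 1 / (2 * t + 1)) = (t + 1) / t := by
    field_simp
    ring
  have hrhs : 18 * (1 / (2 * t + 1)) / (9 - 4 * (1 / (2 * t + 1)) ^ 2) =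
      3 * (1 / (6 * t + 1) + 1 / (6 * t + 5)) := by
    have : 9 - 4 * (1 / (2 * t + 1)) ^ 2 = (6 * t + 1) * (6 * t + 5) / (2 * t + 1) ^ 2 := by
      field_simp
      ring
    rw [this]
    field_simp
    ring
  rwa [hquot, hrhs, Real.log_div (by positivity) (by positivity)] at hle

theorem le_totientSum_six {j : ℕ} (hj : 1 ≤ j) :
    6 / 5 + Real.log j / 3 ≤ totientSum 6 (6 * j) := by
  have hsum : 6 / 5 + Real.log j / 3 ≤
      ∑ i ∈ range j, (1 / ((6 * i + 1 : ℕ) : ℝ) + 1 / ((6 * i + 5 : ℕ) : ℝ)) := by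
    induction j, hj using Nat.le_induction with
    | base => norm_num
    | succ j hj ih =>
      have := log_add_one_sub_log_le (t := j) (by exact_mod_cast hj)
      rw [sum_range_succ]
      push_cast at ih ⊢
      linarith
  rw [← sum_range_coprime_six fun m : ℕ => 1 / (m : ℝ)] at hsum
  refine hsum.trans (sum_inv_le_totientSum fun m hm => ?_)
  obtain ⟨hmz, hcop⟩ := mem_filter.1 hm
  exact ⟨fun h => by simp [h] at hcop, mem_range.1 hmz, hcop⟩

theorem totient_eq_prod_sub_one {n : ℕ} (hn : Squarefree n) :
    (n.totient : ℝ) = ∏ p ∈ n.primeFactors, ((p : ℝ) - 1) := by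
  have hprod : (n : ℝ) = ∏ p ∈ n.primeFactors, (p : ℝ) := by
    rw [← Nat.cast_prod, Nat.prod_primeFactors_of_squarefree hn]
  rw [totient_eq_mul_prod]
  nth_rw 1 [hprod]
  rw [← prod_mul_distrib]
  refine prod_congr rfl fun p hp => ?_
  have : (p : ℝ) ≠ 0 := by exact_mod_cast (Nat.prime_of_mem_primeFactors hp).ne_zero
  field_simp

theorem sum_divisors_div_totient {n : ℕ} (hn : Squarefree n) :
    (∑ d ∈ n.divisors, (d : ℝ)) / n.totient =
      ∑ t ∈ n.primeFactors.powerset, ∏ p ∈ t, 2 / ((p : ℝ) - 1) := by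
  have hσ : ∑ d ∈ n.divisors, (d : ℝ) = ∏ p ∈ n.primeFactors, (1 + (p : ℝ)) := by
    simpa using (ArithmeticFunction.IsMultiplicative.prodPrimeFactors_one_add_of_squarefree
      (ArithmeticFunction.isMultiplicative_id.natCast (R := ℝ)) hn).symm
  rw [hσ, totient_eq_prod_sub_one hn, ← prod_div_distrib, ← prod_one_add]
  refine prod_congr rfl fun p hp => ?_
  have : 1 < (p : ℝ) := by exact_mod_cast (Nat.prime_of_mem_primeFactors hp).one_lt
  have : (p : ℝ) - 1 ≠ 0 := by linarith
  field_simp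
  ring

theorem sigmaTotientSum_eq_sum_powerset (k z : ℕ) :
    sigmaTotientSum k z = ∑ t ∈ (sievePrimes k z).powerset,
      (∏ p ∈ t, 2 / ((p : ℝ) - 1)) * #{n ∈ sieveSupport k z | t ⊆ n.primeFactors} := by
  have hfilter : ∀ n ∈ sieveSupport k z,
      {t ∈ (sievePrimes k z).powerset | t ⊆ n.primeFactors} = n.primeFactors.powerset :=
    fun n hn => by
      ext t
      simp only [mem_filter, mem_powerset, and_iff_right_iff_imp]
      exact fun ht => ht.trans (primeFactors_subset_sievePrimes hn)
  calc sigmaTotientSum k z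
      = ∑ n ∈ sieveSupport k z, ∑ t ∈ (sievePrimes k z).powerset,
          if t ⊆ n.primeFactors then ∏ p ∈ t, 2 / ((p : ℝ) - 1) else 0 :=
        sum_congr rfl fun n hn => by
          rw [sum_divisors_div_totient (mem_sieveSupport.1 hn).2.1, ← sum_filter, hfilter n hn]
    _ = _ := by
        rw [sum_comm]
        refine sum_congr rfl fun t _ => ?_
        rw [← sum_filter, sum_const, nsmul_eq_mul, mul_comm]

theorem card_sieveSupport_filter_le (k z : ℕ) (t : Finset ℕ) :
    (#{n ∈ sieveSupport k z | t ⊆ n.primeFactors} : ℝ) ≤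
      ((z - 1 : ℕ) : ℝ) / ∏ p ∈ t, (p : ℝ) := by
  have hsub : {n ∈ sieveSupport k z | t ⊆ n.primeFactors} ⊆
      {n ∈ Ioc 0 (z - 1) | ∏ p ∈ t, p ∣ n} := fun n hn => by
    obtain ⟨hn, ht⟩ := mem_filter.1 hn
    obtain ⟨hnz, hsq, -⟩ := mem_sieveSupport.1 hn
    exact mem_filter.2 ⟨mem_Ioc.2 ⟨hsq.ne_zero.bot_lt, Nat.le_sub_one_of_lt hnz⟩,
      (prod_dvd_prod_of_subset _ _ _ ht).trans (Nat.prod_primeFactors_dvd n)⟩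
  have hcard := card_le_card hsub
  rw [Nat.Ioc_filter_dvd_card_eq_div] at hcard
  rw [← Nat.cast_prod]
  exact (Nat.cast_le.2 hcard).trans Nat.cast_div_le

theorem prod_range_one_add_le (k : ℕ) :
    ∏ i ∈ range k, (1 + 2 / ((2 * (i : ℝ) + 4) * (2 * i + 5))) ≤
      4 / 3 * ((2 * k + 3) / (2 * k + 4)) := by
  induction k with
  | zero => norm_num
  | succ k ih =>
    rw [prod_range_succ]
    calc _ ≤ 4 / 3 * ((2 * (k : ℝ) + 3) / (2 * k + 4)) *
          (1 + 2 / ((2 * (k : ℝ) + 4) * (2 * k + 5))) := by gcongr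
      _ ≤ 4 / 3 * ((2 * ((k + 1 : ℕ) : ℝ) + 3) / (2 * (k + 1 : ℕ) + 4)) := by
        push_cast
        rw [mul_assoc]
        gcongr
        rw [← sub_nonneg]
        have : (2 * ((k : ℝ) + 1) + 3) / (2 * (k + 1) + 4) - (2 * (k : ℝ) + 3) / (2 * k + 4) *
            (1 + 2 / ((2 * (k : ℝ) + 4) * (2 * k + 5))) =
              4 / ((2 * k + 4) ^ 2 * (2 * k + 5) * (2 * k + 6)) := by
          field_simp
          ring
        rw [this]
        positivity

theorem prod_one_add_le_four_thirds {s : Finset ℕ} (hs : ∀ p ∈ s, Odd p ∧ 5 ≤ p) :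
    ∏ p ∈ s, (1 + 2 / (((p : ℝ) - 1) * p)) ≤ 4 / 3 := by
  obtain ⟨k, hk⟩ := s.exists_nat_subset_range
  let T : Finset ℕ := (range k).image fun i => 2 * i + 5
  have hsub : s ⊆ T := fun p hp => by
    obtain ⟨⟨i, rfl⟩, hi⟩ := hs p hp
    have := mem_range.1 (hk hp)
    exact mem_image.2 ⟨i - 2, mem_range.2 (by lia), by lia⟩
  have hfactor : ∀ p ∈ T, (1 : ℝ) ≤ 1 + 2 / (((p : ℝ) - 1) * p) := by
    refine forall_mem_image.2 fun i _ => ?_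
    have : (0 : ℝ) ≤ ((2 * i + 5 : ℕ) : ℝ) - 1 := by
      push_cast
      linarith [Nat.cast_nonneg (α := ℝ) i]
    have : (0 : ℝ) ≤ 2 / ((((2 * i + 5 : ℕ) : ℝ) - 1) * (2 * i + 5 : ℕ)) := by positivity
    linarith
  calc _ ≤ ∏ p ∈ T, (1 + 2 / (((p : ℝ) - 1) * p)) :=
        prod_le_prod_of_subset_of_one_le hsub
          (fun p hp => zero_le_one.trans (hfactor p (hsub hp))) fun p hp _ => hfactor p hp
    _ = ∏ i ∈ range k, (1 + 2 / ((2 * (i : ℝ) + 4) * (2 * i + 5))) := by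
        rw [prod_image (by simp)]
        refine prod_congr rfl fun i _ => ?_
        push_cast
        ring_nf
    _ ≤ 4 / 3 * ((2 * k + 3) / (2 * k + 4)) := prod_range_one_add_le k
    _ ≤ 4 / 3 := mul_le_of_le_one_right (by norm_num) ((div_le_one (by positivity)).2 (by linarith))

theorem odd_and_five_le_of_mem_sievePrimes_six {z p : ℕ} (hp : p ∈ sievePrimes 6 z) :
    Odd p ∧ 5 ≤ p := by
  obtain ⟨-, hpp, hp6⟩ := mem_sievePrimes.1 hp
  have h₂ : p ≠ 2 := by rintro rfl; norm_num at hp6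
  have h₃ : p ≠ 3 := by rintro rfl; norm_num at hp6
  have h₄ : p ≠ 4 := by rintro rfl; norm_num at hpp
  have := hpp.two_le
  exact ⟨hpp.odd_of_ne_two h₂, by lia⟩

theorem sigmaTotientSum_six_le {j : ℕ} (hj : 1 ≤ j) : sigmaTotientSum 6 (6 * j) ≤ 4 * j := by
  set P := (sievePrimes 6 (6 * j)).powerset
  have hcast : ((6 * j - 1 : ℕ) : ℝ) = 6 * j - 1 := by
    rw [Nat.cast_sub (by lia)]
    push_cast
    rfl
  have hone : (#(sieveSupport 6 (6 * j)) : ℝ) ≤ 2 * j := by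
    have := card_le_card (show sieveSupport 6 (6 * j) ⊆ {n ∈ range (6 * j) | n.Coprime 6} from
      fun n hn => mem_filter.2
        ⟨mem_range.2 (mem_sieveSupport.1 hn).1, (mem_sieveSupport.1 hn).2.2⟩)
    rw [card_coprime_six] at this
    exact_mod_cast this
  have hterm : ∀ t ∈ P.erase ∅, (∏ p ∈ t, 2 / ((p : ℝ) - 1)) *
      #{n ∈ sieveSupport 6 (6 * j) | t ⊆ n.primeFactors} ≤
        (6 * j - 1) * ∏ p ∈ t, 2 / (((p : ℝ) - 1) * p) := fun t ht => by
    have hnonneg : 0 ≤ ∏ p ∈ t, 2 / ((p : ℝ) - 1) := prod_nonneg fun p hp => by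
      have hp5 := (odd_and_five_le_of_mem_sievePrimes_six
        (mem_powerset.1 (mem_of_mem_erase ht) hp)).2
      have : (5 : ℝ) ≤ p := by exact_mod_cast hp5
      exact div_nonneg zero_le_two (by linarith)
    refine (mul_le_mul_of_nonneg_left (card_sieveSupport_filter_le _ _ t) hnonneg).trans_eq ?_
    simp_rw [hcast, div_mul_eq_div_div]
    rw [prod_div_distrib (f := fun p : ℕ => 2 / ((p : ℝ) - 1))]
    ring
  have hprod : ∑ t ∈ P.erase ∅, ∏ p ∈ t, 2 / (((p : ℝ) - 1) * p) ≤ 1 / 3 := by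
    have := prod_one_add_le_four_thirds fun p hp =>
      odd_and_five_le_of_mem_sievePrimes_six (z := 6 * j) hp
    rw [prod_one_add, ← add_sum_erase _ _ (empty_mem_powerset _), prod_empty] at this
    linarith
  have hj' : (1 : ℝ) ≤ j := by exact_mod_cast hj
  rw [sigmaTotientSum_eq_sum_powerset, ← add_sum_erase _ _ (empty_mem_powerset _)]
  have hsum := sum_le_sum hterm
  rw [← mul_sum] at hsum
  have := mul_le_mul_of_nonneg_left hprod (show (0 : ℝ) ≤ 6 * j - 1 by linarith)
  simp only [prod_empty, one_mul, empty_subset, filter_true]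
  linarith

end TotientSums

section SieveLevel

theorem sieveSupport_two (k : ℕ) : sieveSupport k 2 = {1} := by
  ext n
  rw [mem_sieveSupport, Finset.mem_singleton]
  refine ⟨fun ⟨_, hsq, _⟩ => ?_, by rintro rfl; norm_num⟩
  have := hsq.ne_zero
  lia

theorem log_le_mul_div_add_three {b : ℝ} (hb : 1 < b) (hb' : b ≤ 150) :
    Real.log b ≤ 6 * b / (b + 3) := by
  have hb0 : 0 < b := by linarith
  have hlog_two := Real.log_two_lt_d9
  rw [le_div_iff₀ (by linarith)]
  rcases le_total b (9 / 2) with hsmall | hlarge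
  · nlinarith [Real.log_le_sub_one_of_pos hb0]
  rcases le_total b 30 with hmid | hlarge
  · have : Real.log b ≤ 5 * Real.log 2 := by
      simpa using Real.log_le_log hb0 (show b ≤ 2 ^ 5 by linarith)
    nlinarith
  · have hquot := Real.log_le_sub_one_of_pos (show (0 : ℝ) < 150 / 2 ^ 7 by norm_num)
    rw [Real.log_div (by norm_num) (by norm_num), Real.log_pow] at hquot
    have := Real.log_le_log hb0 hb'
    push_cast at hquot
    nlinarith

theorem log_le_sub_div_of_mem_Icc {s : ℝ} (hs : 150 ≤ s) (hs' : s ≤ 600) :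
    Real.log s ≤ 36 / 5 - 288 / s := by
  have hs0 : 0 < s := by linarith
  have htangent := Real.log_le_sub_one_of_pos (show 0 < s / 300 by positivity)
  have hlog : Real.log 300 ≤ 143 / 25 := by
    have hquot := Real.log_le_sub_one_of_pos (show (0 : ℝ) < 300 / 2 ^ 8 by norm_num)
    rw [Real.log_div (by norm_num) (by norm_num), Real.log_pow] at hquot
    have := Real.log_two_lt_d9
    push_cast at hquot
    linarith
  have : 288 / s ≤ 62 / 25 - s / 300 := by
    rw [div_le_iff₀ hs0]
    nlinarith
  rw [Real.log_div hs0.ne' (by norm_num)] at htangent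
  linarith

theorem log_add_div_le {b : ℝ} {j : ℕ} (hj : 1 ≤ j) (hb : 150 * (j : ℝ) ^ 2 ≤ b)
    (hb' : b ≤ 600 * (j : ℝ) ^ 2) :
    Real.log b + 18 * ((4 * j) ^ 2 / b) ≤ 6 * (6 / 5 + Real.log j / 3) := by
  have : (0 : ℝ) < j := by exact_mod_cast hj
  have hb0 : 0 < b := lt_of_lt_of_le (by positivity) hb
  have hlog := log_le_sub_div_of_mem_Icc (s := b / (j : ℝ) ^ 2)
    (by rwa [le_div_iff₀ (by positivity)]) (by rwa [div_le_iff₀ (by positivity)])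
  have heq : 288 / (b / (j : ℝ) ^ 2) = 18 * ((4 * j) ^ 2 / b) := by
    field_simp
    ring
  rw [Real.log_div hb0.ne' (by positivity), Real.log_pow, heq] at hlog
  push_cast at hlog
  linarith

theorem exists_sq_mul_le {b : ℝ} (hb : 150 ≤ b) :
    ∃ j : ℕ, 1 ≤ j ∧ 150 * (j : ℝ) ^ 2 ≤ b ∧ b ≤ 600 * (j : ℝ) ^ 2 := by
  have hsq : √(b / 150) ^ 2 = b / 150 := Real.sq_sqrt (by positivity)
  have hj : 1 ≤ ⌊√(b / 150)⌋₊ :=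
    Nat.le_floor (by rw [Nat.cast_one, Real.one_le_sqrt]; linarith)
  have hj' : (1 : ℝ) ≤ ⌊√(b / 150)⌋₊ := by exact_mod_cast hj
  have hle : (⌊√(b / 150)⌋₊ : ℝ) ≤ √(b / 150) := Nat.floor_le (by positivity)
  have hlt : √(b / 150) < ⌊√(b / 150)⌋₊ + 1 := Nat.lt_floor_add_one _
  exact ⟨_, hj, by nlinarith, by nlinarith⟩

theorem exists_sieve_level {b : ℝ} (hb : 1 < b) :
    ∃ z : ℕ, 1 < z ∧ (z : ℝ) ≤ b + 1 ∧
      Real.log b * (totientSum 6 z / 3 + sigmaTotientSum 6 z ^ 2 / b) ≤ 2 * totientSum 6 z ^ 2 := by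
  have : 0 < b := by linarith
  rcases le_total b 150 with hsmall | hlarge
  · refine ⟨2, by norm_num, by push_cast; linarith, ?_⟩
    have hlog := log_le_mul_div_add_three hb hsmall
    have hvalues : totientSum 6 2 = 1 ∧ sigmaTotientSum 6 2 = 1 := by
      simp [totientSum, sigmaTotientSum, sieveSupport_two]
    rw [le_div_iff₀ (by linarith)] at hlog
    rw [hvalues.1, hvalues.2, ← sub_nonneg]
    have : 2 * 1 ^ 2 - Real.log b * (1 / 3 + 1 ^ 2 / b) =
        (6 * b - Real.log b * (b + 3)) / (3 * b) := by
      field_simp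
      ring
    rw [this]
    exact div_nonneg (by linarith) (by positivity)
  · obtain ⟨j, hj, hjb, hbj⟩ := exists_sq_mul_le hlarge
    have hj' : (1 : ℝ) ≤ j := by exact_mod_cast hj
    refine ⟨6 * j, by lia, by push_cast; nlinarith, ?_⟩
    have hL := (log_add_div_le hj hjb hbj).trans
      (mul_le_mul_of_nonneg_left (le_totientSum_six hj) (by norm_num))
    have hσ : sigmaTotientSum 6 (6 * j) ^ 2 / b ≤ (4 * j) ^ 2 / b := by
      gcongr
      · exact Finset.sum_nonneg fun n _ => by positivity
      · exact sigmaTotientSum_six_le hj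
    have hL0 : 0 < totientSum 6 (6 * j) := totientSum_pos (by lia)
    have hκ : 0 ≤ (4 * (j : ℝ)) ^ 2 / b := by positivity
    have hlog := Real.log_nonneg hb.le
    calc _ ≤ Real.log b * (totientSum 6 (6 * j) / 3 + (4 * j) ^ 2 / b) := by gcongr
      _ ≤ (6 * totientSum 6 (6 * j) - 18 * ((4 * j) ^ 2 / b)) *
          (totientSum 6 (6 * j) / 3 + (4 * j) ^ 2 / b) := by
        gcongr
        linarith
      _ ≤ _ := by nlinarith

theorem sieve_bound_le {b X ℓ L σ : ℝ} (hb : 0 < b) (hX : 2 * b ≤ X) (hℓ : 0 < ℓ) (hL : 0 < L)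
    (h : ℓ * (L / 3 + σ ^ 2 / b) ≤ 2 * L ^ 2) : X / 3 / L + 2 * (σ / L) ^ 2 ≤ 2 * X / ℓ := by
  have hX0 : 0 < X := by linarith
  have hσ : 2 * σ ^ 2 ≤ X * (σ ^ 2 / b) := by
    rw [← mul_div_assoc, le_div_iff₀ hb]
    nlinarith [sq_nonneg σ]
  calc X / 3 / L + 2 * (σ / L) ^ 2 = (X * (L / 3) + 2 * σ ^ 2) / L ^ 2 := by field_simp
    _ ≤ X * (L / 3 + σ ^ 2 / b) / L ^ 2 := by
      gcongr
      linarith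
    _ ≤ 2 * X / ℓ := by
      rw [div_le_div_iff₀ (by positivity) hℓ]
      nlinarith

end SieveLevel

section MonotoneSums

open Finset

theorem sum_Icc_int_add {M : Type*} [AddCommMonoid M] (f : ℤ → M) (N : ℤ) (d : ℕ) :
    ∑ n ∈ Icc N (N + d), f n = ∑ i ∈ range (d + 1), f (N + i) :=
  sum_nbij' (fun n => (n - N).toNat) (fun i => N + i)
    (fun n hn => by rw [mem_Icc] at hn; rw [mem_range]; lia)
    (fun i hi => by rw [mem_range] at hi; rw [mem_Icc]; lia)
    (fun n hn => by rw [mem_Icc] at hn; lia) (fun i _ => by simp)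
    (fun n hn => by rw [mem_Icc] at hn; congr 1; lia)

theorem integral_nonneg_and_le {g : ℝ → ℝ} {a b C : ℝ} (hab : a ≤ b)
    (hg : IntervalIntegrable g volume a b) (hC : ∀ t ∈ Set.Icc a b, 0 ≤ g t ∧ g t ≤ C) :
    0 ≤ ∫ t in a..b, g t ∧ ∫ t in a..b, g t ≤ C * (b - a) := by
  refine ⟨intervalIntegral.integral_nonneg hab fun t ht => (hC t ht).1, ?_⟩
  have := intervalIntegral.integral_mono_on hab hg intervalIntegrable_const fun t ht => (hC t ht).2
  rwa [intervalIntegral.integral_const, smul_eq_mul, mul_comm] at this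

variable {g : ℝ → ℝ}

theorem integral_le_sum_Icc_int_of_antitoneOn {N K : ℤ} (hNK : N ≤ K)
    (hg : AntitoneOn g (Set.Icc N K)) :
    (∫ t in (N : ℝ)..K, g t) + g K ≤ ∑ n ∈ Icc N K, g n ∧
      ∑ n ∈ Icc N K, g n ≤ g N + ∫ t in (N : ℝ)..K, g t := by
  obtain ⟨d, rfl⟩ := Int.le.dest hNK
  push_cast at hg ⊢
  have hlow := hg.integral_le_sum
  have hupp := hg.sum_le_integral
  have hlast := sum_range_succ (fun i : ℕ => g (N + i)) d
  have hfirst := sum_range_succ' (fun i : ℕ => g (N + i)) d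
  rw [Nat.cast_zero, add_zero] at hfirst
  rw [sum_Icc_int_add (fun n : ℤ => g n)]
  push_cast at hlow hupp hlast hfirst ⊢
  constructor <;> linarith

variable {a U C : ℝ}

theorem abs_sum_int_sub_integral_le_of_antitoneOn (haU : a ≤ U)
    (hg : AntitoneOn g (Set.Icc a U)) (hC : ∀ t ∈ Set.Icc a U, 0 ≤ g t ∧ g t ≤ C) :
    |∑ n ∈ Icc ⌈a⌉ ⌊U⌋, g n - ∫ t in a..U, g t| ≤ C := by
  have hint : ∀ u v, a ≤ u → u ≤ v → v ≤ U → IntervalIntegrable g volume u v :=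
    fun u v hu huv hv =>
      (hg.mono (Set.uIcc_of_le huv ▸ Set.Icc_subset_Icc hu hv)).intervalIntegrable
  have hbound : ∀ u v C', a ≤ u → u ≤ v → v ≤ U → (∀ t ∈ Set.Icc u v, g t ≤ C') →
      0 ≤ ∫ t in u..v, g t ∧ ∫ t in u..v, g t ≤ C' * (v - u) := fun u v C' hu huv hv hC' =>
    integral_nonneg_and_le huv (hint u v hu huv hv) fun t ht =>
      ⟨(hC t (Set.Icc_subset_Icc hu hv ht)).1, hC' t ht⟩
  have hC0 : 0 ≤ C := (hC a ⟨le_rfl, haU⟩).1.trans (hC a ⟨le_rfl, haU⟩).2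
  have hceil : ⌈a⌉ < a + 1 := Int.ceil_lt_add_one a
  have hfloor : U < ⌊U⌋ + 1 := Int.lt_floor_add_one U
  rcases lt_or_ge ⌊U⌋ ⌈a⌉ with hlt | hle
  · have hlt' : (⌊U⌋ : ℝ) + 1 ≤ ⌈a⌉ := by exact_mod_cast hlt
    obtain ⟨h0, h1⟩ := hbound a U C le_rfl haU le_rfl fun t ht => (hC t ht).2
    rw [Icc_eq_empty_of_lt hlt, sum_empty, zero_sub, abs_neg, abs_of_nonneg h0]
    nlinarith
  have haN : a ≤ ⌈a⌉ := Int.le_ceil a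
  have hNK : (⌈a⌉ : ℝ) ≤ ⌊U⌋ := by exact_mod_cast hle
  have hKU : (⌊U⌋ : ℝ) ≤ U := Int.floor_le U
  obtain ⟨hlow, hupp⟩ := integral_le_sum_Icc_int_of_antitoneOn hle
    (hg.mono (Set.Icc_subset_Icc haN hKU))
  obtain ⟨hhead, hhead'⟩ := hbound a ⌈a⌉ C le_rfl haN (hNK.trans hKU) fun t ht =>
    (hC t ⟨ht.1, ht.2.trans (hNK.trans hKU)⟩).2
  obtain ⟨htail, htail'⟩ := hbound ⌊U⌋ U (g ⌊U⌋) (haN.trans hNK) hKU le_rfl fun t ht =>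
    hg ⟨haN.trans hNK, hKU⟩ ⟨haN.trans (hNK.trans ht.1), ht.2⟩ ht.1
  have hgN := hC ⌈a⌉ ⟨haN, hNK.trans hKU⟩
  have hgK := hC ⌊U⌋ ⟨haN.trans hNK, hKU⟩
  rw [← intervalIntegral.integral_add_adjacent_intervals (hint a ⌈a⌉ le_rfl haN (hNK.trans hKU))
      (hint ⌈a⌉ U haN (hNK.trans hKU) le_rfl),
    ← intervalIntegral.integral_add_adjacent_intervals (hint ⌈a⌉ ⌊U⌋ haN hNK hKU)
      (hint ⌊U⌋ U (haN.trans hNK) hKU le_rfl), abs_le]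
  constructor <;> nlinarith

theorem abs_sum_int_sub_integral_le (haU : a ≤ U)
    (hg : MonotoneOn g (Set.Icc a U) ∨ AntitoneOn g (Set.Icc a U))
    (hC : ∀ t ∈ Set.Icc a U, 0 ≤ g t ∧ g t ≤ C) :
    |∑ n ∈ Icc ⌈a⌉ ⌊U⌋, g n - ∫ t in a..U, g t| ≤ C := by
  rcases hg with hmono | hanti
  · have hmaps : ∀ t ∈ Set.Icc (-U) (-a), -t ∈ Set.Icc a U := fun t ht =>
      ⟨by linarith [ht.2], by linarith [ht.1]⟩
    have h := abs_sum_int_sub_integral_le_of_antitoneOn (g := fun t => g (-t)) (neg_le_neg haU)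
      (fun s hs t ht hst => hmono (hmaps t ht) (hmaps s hs) (neg_le_neg hst))
      fun t ht => hC _ (hmaps t ht)
    rw [intervalIntegral.integral_comp_neg, neg_neg, neg_neg, Int.ceil_neg, Int.floor_neg] at h
    rwa [sum_nbij' (t := Icc (-⌊U⌋) (-⌈a⌉)) (g := fun n : ℤ => g (-n)) (fun n => -n)
      (fun n => -n) (by simp +contextual) (by simp +contextual [neg_le, le_neg]) (by simp)
      (by simp) (by simp)]
  · exact abs_sum_int_sub_integral_le_of_antitoneOn haU hanti hC

theorem abs_sum_progression_sub_integral_le {q : ℝ} (hq : 0 < q) (r : ℝ) (haU : a ≤ U)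
    (hg : MonotoneOn g (Set.Icc a U) ∨ AntitoneOn g (Set.Icc a U))
    (hC : ∀ t ∈ Set.Icc a U, 0 ≤ g t ∧ g t ≤ C) :
    |∑ n ∈ Icc ⌈(a - r) / q⌉ ⌊(U - r) / q⌋, g (r + q * n) - (∫ t in a..U, g t) / q| ≤ C := by
  have hmaps : ∀ u ∈ Set.Icc ((a - r) / q) ((U - r) / q), r + q * u ∈ Set.Icc a U := by
    rintro u ⟨hu, hu'⟩
    rw [div_le_iff₀ hq] at hu
    rw [le_div_iff₀ hq] at hu'
    constructor <;> linarith
  have hcancel : ∀ u : ℝ, r + q * ((u - r) / q) = u := fun u => by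
    field_simp
    ring
  have hle : ∀ u v : ℝ, u ≤ v → r + q * u ≤ r + q * v := fun u v huv => by gcongr
  have h := abs_sum_int_sub_integral_le (g := fun u => g (r + q * u)) (a := (a - r) / q)
    (U := (U - r) / q) (C := C) (by gcongr)
    (hg.imp (fun h u hu v hv huv => h (hmaps u hu) (hmaps v hv) (hle u v huv))
      fun h u hu v hv huv => h (hmaps u hu) (hmaps v hv) (hle u v huv))
    fun u hu => hC _ (hmaps u hu)
  rwa [intervalIntegral.integral_comp_add_mul _ hq.ne', hcancel, hcancel, smul_eq_mul,
    ← div_eq_inv_mul] at h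

theorem mem_Icc_ceil_floor (ha : 0 < a) {n : ℕ} (haU : a ≤ U) :
    n ∈ Icc ⌈a⌉₊ ⌊U⌋₊ ↔ (n : ℝ) ∈ Set.Icc a U := by
  rw [mem_Icc, Nat.ceil_le, Nat.le_floor_iff (ha.le.trans haU), Set.mem_Icc]

theorem neg_one_lt_of_pos_add_mul {m k r : ℕ} (hr : r < k) {i : ℤ}
    (hi : (0 : ℝ) < m * r + m * k * i) : -1 < i := by
  by_contra! hi'
  have hi'' : (0 : ℤ) < m * r + m * k * i := by exact_mod_cast hi
  have : (r : ℤ) < k := by exact_mod_cast hr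
  nlinarith [mul_nonneg (Nat.cast_nonneg (α := ℤ) m) (Nat.cast_nonneg (α := ℤ) k),
    Nat.cast_nonneg (α := ℤ) m]

theorem sum_filter_div_mod_eq_sum_progression {m k r : ℕ} (hm : 0 < m) (hr : r < k) (ha : 0 < a)
    (haU : a ≤ U) (g : ℝ → ℝ) :
    ∑ n ∈ Icc ⌈a⌉₊ ⌊U⌋₊ with m ∣ n ∧ n / m % k = r, g n =
      ∑ i ∈ Icc ⌈(a - m * r) / (m * k)⌉ ⌊(U - m * r) / (m * k)⌋, g (m * r + m * k * i) := by
  have hk : 0 < k := r.zero_le.trans_lt hr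
  have hmem : ∀ i : ℤ, i ∈ Icc ⌈(a - m * r) / (m * k)⌉ ⌊(U - m * r) / (m * k)⌋ ↔
      (m * r + m * k * i : ℝ) ∈ Set.Icc a U := fun i => by
    rw [mem_Icc, Int.ceil_le, Int.le_floor, div_le_iff₀ (by positivity),
      le_div_iff₀ (by positivity), Set.mem_Icc]
    constructor <;> rintro ⟨h, h'⟩ <;> constructor <;> linarith
  have hparam : ∀ n : ℕ, m ∣ n ∧ n / m % k = r → m * r + m * k * (n / m / k) = n := by
    rintro n ⟨hmn, rfl⟩
    rw [mul_assoc, ← mul_add, Nat.mod_add_div, Nat.mul_div_cancel' hmn]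
  have hparam' : ∀ n : ℕ, m ∣ n ∧ n / m % k = r → (m * r + m * k * (n / m / k : ℕ) : ℝ) = n :=
    fun n hn => by exact_mod_cast hparam n hn
  refine sum_nbij (fun n => ((n / m / k : ℕ) : ℤ)) (fun n hn => ?_) (fun n hn n' hn' heq => ?_)
    (fun i hi => ?_) fun n hn => ?_
  · rw [mem_filter, mem_Icc_ceil_floor ha haU] at hn
    rw [hmem, Int.cast_natCast, hparam' n hn.2]
    exact hn.1
  · rw [← hparam n (mem_filter.1 hn).2, ← hparam n' (mem_filter.1 hn').2, Int.ofNat_inj.1 heq]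
  · have hi' := (hmem i).1 hi
    lift i to ℕ using by linarith [neg_one_lt_of_pos_add_mul hr (ha.trans_le hi'.1)]
    have hdiv : m * (r + k * i) / m = r + k * i := Nat.mul_div_cancel_left _ hm
    refine ⟨m * (r + k * i), mem_filter.2 ⟨?_, dvd_mul_right _ _, ?_⟩, ?_⟩
    · rw [mem_Icc_ceil_floor ha haU]
      convert hi' using 1
      push_cast
      ring
    · rw [hdiv, Nat.add_mul_mod_self_left, Nat.mod_eq_of_lt hr]
    · simp only [hdiv]
      rw [Nat.add_mul_div_left _ _ hk, Nat.div_eq_of_lt hr, zero_add]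
  · rw [Int.cast_natCast, hparam' n (mem_filter.1 hn).2]

theorem abs_sum_residue_sub_integral_le {m k r : ℕ} (hm : 0 < m) (hr : r < k) (ha : 0 < a)
    (haU : a ≤ U) (hg : MonotoneOn g (Set.Icc a U) ∨ AntitoneOn g (Set.Icc a U))
    (hC : ∀ t ∈ Set.Icc a U, 0 ≤ g t ∧ g t ≤ C) :
    |∑ n ∈ Icc ⌈a⌉₊ ⌊U⌋₊ with m ∣ n ∧ n / m % k = r, g n -
      (∫ t in a..U, g t) / (m * k)| ≤ C := by
  have hk : 0 < k := r.zero_le.trans_lt hr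
  rw [sum_filter_div_mod_eq_sum_progression hm hr ha haU]
  exact abs_sum_progression_sub_integral_le (by positivity) _ haU hg hC

theorem abs_sum_coprime_multiples_sub_integral_le {m k : ℕ} (hm : 0 < m) (hk : 0 < k)
    (hmk : m.Coprime k) (ha : 0 < a) (haU : a ≤ U)
    (hg : MonotoneOn g (Set.Icc a U) ∨ AntitoneOn g (Set.Icc a U))
    (hC : ∀ t ∈ Set.Icc a U, 0 ≤ g t ∧ g t ≤ C) :
    |∑ n ∈ Icc ⌈a⌉₊ ⌊U⌋₊ with n.Coprime k ∧ m ∣ n, g n -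
      k.totient / k * (∫ t in a..U, g t) / m| ≤ k.totient * C := by
  have hmod : ∀ l : ℕ, k.Coprime (l % k) ↔ l.Coprime k := fun l => by
    rw [Nat.Coprime, Nat.gcd_comm, ← Nat.gcd_rec, Nat.gcd_comm, ← Nat.coprime_iff_gcd_eq_one]
  have hmaps : ∀ n ∈ {n ∈ Icc ⌈a⌉₊ ⌊U⌋₊ | n.Coprime k ∧ m ∣ n},
      n / m % k ∈ {r ∈ range k | k.Coprime r} := fun n hn => by
    obtain ⟨-, hcop, l, rfl⟩ := mem_filter.1 hn
    rw [Nat.mul_div_cancel_left l hm, mem_filter, mem_range, hmod]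
    exact ⟨Nat.mod_lt _ hk, hcop.coprime_mul_left⟩
  have hfiber : ∀ r ∈ {r ∈ range k | k.Coprime r},
      {n ∈ {n ∈ Icc ⌈a⌉₊ ⌊U⌋₊ | n.Coprime k ∧ m ∣ n} | n / m % k = r} =
        {n ∈ Icc ⌈a⌉₊ ⌊U⌋₊ | m ∣ n ∧ n / m % k = r} := fun r hr => by
    rw [filter_filter]
    refine filter_congr fun n _ => ⟨fun h => ⟨h.1.2, h.2⟩, ?_⟩
    rintro ⟨⟨l, rfl⟩, hl⟩
    refine ⟨⟨hmk.mul_left ?_, dvd_mul_right m l⟩, hl⟩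
    rw [Nat.mul_div_cancel_left l hm] at hl
    rw [← hmod, hl]
    exact (mem_filter.1 hr).2
  have hmain : k.totient / k * (∫ t in a..U, g t) / m =
      ∑ r ∈ range k with k.Coprime r, (∫ t in a..U, g t) / (m * k) := by
    rw [sum_const, nsmul_eq_mul, ← Nat.totient]
    field_simp
  rw [← sum_fiberwise_of_maps_to hmaps, hmain, ← sum_sub_distrib, Nat.totient]
  refine (abs_sum_le_sum_abs _ _).trans
    ((sum_le_card_nsmul _ _ C fun r hr => ?_).trans_eq (nsmul_eq_mul _ _))
  rw [hfiber r hr]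
  exact abs_sum_residue_sub_integral_le hm (mem_range.1 (mem_filter.1 hr).1) ha haU hg hC

theorem sum_primes_Icc_le_selberg {k z : ℕ} (hk : 0 < k) (hz : 1 < z) (ha : 0 < a)
    (haU : a ≤ U) (hza : z ≤ a) (hka : ∀ p : ℕ, p.Prime → a ≤ p → p.Coprime k)
    (hg : MonotoneOn g (Set.Icc a U) ∨ AntitoneOn g (Set.Icc a U))
    (hC : ∀ t ∈ Set.Icc a U, 0 ≤ g t ∧ g t ≤ C) :
    ∑ p ∈ Icc ⌈a⌉₊ ⌊U⌋₊ with p.Prime, g p ≤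
      k.totient / k * (∫ t in a..U, g t) / totientSum k z +
        k.totient * C * (sigmaTotientSum k z / totientSum k z) ^ 2 := by
  have habs : ∀ n ∈ Icc ⌈a⌉₊ ⌊U⌋₊, |g n| = g n := fun n hn =>
    abs_of_nonneg (hC n ((mem_Icc_ceil_floor ha haU).1 hn)).1
  have hprimes : {p ∈ Icc ⌈a⌉₊ ⌊U⌋₊ | p.Prime} =
      {p ∈ {n ∈ Icc ⌈a⌉₊ ⌊U⌋₊ | n.Coprime k} | p.Prime ∧ z ≤ p} := by
    rw [filter_filter]
    refine filter_congr fun p hp => ⟨fun h => ?_, fun h => h.2.1⟩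
    have hap := ((mem_Icc_ceil_floor ha haU).1 hp).1
    exact ⟨hka p h hap, h, by exact_mod_cast hza.trans hap⟩
  rw [hprimes, ← sum_congr rfl fun n hn => habs n (mem_filter.1 (mem_filter.1 hn).1).1]
  refine sum_primes_ge_le_selberg hz _ (fun n => abs_nonneg (g n)) fun m hm hmk => ?_
  rw [filter_filter, sum_congr rfl fun n hn => habs n (mem_filter.1 hn).1]
  exact abs_sum_coprime_multiples_sub_integral_le hm hk hmk ha haU hg hC

end MonotoneSums

section Kernel

theorem besselI0_term_nonneg (y : ℝ) (n : ℕ) :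
    0 ≤ (y / 2) ^ (2 * n) / ((n.factorial : ℝ) ^ 2) := by
  rw [pow_mul]
  positivity

theorem summable_besselI0 (y : ℝ) :
    Summable fun n : ℕ => (y / 2) ^ (2 * n) / ((n.factorial : ℝ) ^ 2) := by
  refine .of_nonneg_of_le (besselI0_term_nonneg y) (fun n => ?_)
    (Real.summable_pow_div_factorial ((y / 2) ^ 2))
  have hfact : (1 : ℝ) ≤ n.factorial := by exact_mod_cast n.factorial_pos
  rw [pow_mul]
  gcongr
  exact le_self_pow₀ hfact two_ne_zero

theorem besselI0_nonneg (y : ℝ) : 0 ≤ besselI0 y := tsum_nonneg (besselI0_term_nonneg y)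

theorem besselI0_le_of_abs_le {y c : ℝ} (h : |y| ≤ |c|) : besselI0 y ≤ besselI0 c := by
  refine (summable_besselI0 y).tsum_le_tsum (fun n => ?_) (summable_besselI0 c)
  have hsq := sq_le_sq.2 h
  simp only [pow_mul, div_pow]
  gcongr

theorem measurable_besselI0 : Measurable besselI0 := by
  refine measurable_of_tendsto_metrizable
    (f := fun N y => ∑ n ∈ Finset.range N, (y / 2) ^ (2 * n) / ((n.factorial : ℝ) ^ 2))
    (fun N => by fun_prop) ?_
  rw [tendsto_pi_nhds]
  exact fun y => (summable_besselI0 y).hasSum.tendsto_sum_nat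

theorem measurable_chiStar (A : Set ℝ) : Measurable (chiStar A) :=
  Measurable.ite isOpen_interior.measurableSet measurable_const
    (Measurable.ite isClosed_frontier.measurableSet measurable_const measurable_const)

theorem chiStar_nonneg (A : Set ℝ) (t : ℝ) : 0 ≤ chiStar A t := by
  rw [chiStar]
  split_ifs <;> norm_num

theorem chiStar_le_one (A : Set ℝ) (t : ℝ) : chiStar A t ≤ 1 := by
  rw [chiStar]
  split_ifs <;> norm_num

theorem chiStar_eq_zero {A : Set ℝ} (hA : IsClosed A) {t : ℝ} (ht : t ∉ A) : chiStar A t = 0 := by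
  rw [chiStar, if_neg fun h => ht (interior_subset h), if_neg fun h => ht (hA.frontier_subset h)]

theorem div_two_mul_sinh_nonneg (c : ℝ) : 0 ≤ c / (2 * Real.sinh c) := by
  rcases le_total 0 c with hc | hc
  · exact div_nonneg hc (mul_nonneg zero_le_two (Real.sinh_nonneg_iff.2 hc))
  · exact div_nonneg_of_nonpos hc
      (mul_nonpos_of_nonneg_of_nonpos zero_le_two (Real.sinh_nonpos_iff.2 hc))

variable (c : ℝ) {ε t u : ℝ}

theorem eta_nonneg (y : ℝ) : 0 ≤ eta c y :=
  mul_nonneg (mul_nonneg (chiStar_nonneg _ _) (div_two_mul_sinh_nonneg c)) (besselI0_nonneg _)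

theorem eta_le (y : ℝ) : eta c y ≤ c / (2 * Real.sinh c) * besselI0 c := by
  have harg : |c * √(1 - y ^ 2)| ≤ |c| := by
    rw [abs_mul, abs_of_nonneg (Real.sqrt_nonneg _)]
    exact mul_le_of_le_one_right (abs_nonneg c) (Real.sqrt_le_one.2 (by nlinarith))
  exact mul_le_mul (mul_le_of_le_one_left (div_two_mul_sinh_nonneg c) (chiStar_le_one _ _))
    (besselI0_le_of_abs_le harg) (besselI0_nonneg _) (div_two_mul_sinh_nonneg c)

theorem eta_eq_zero {y : ℝ} (hy : y ∉ Set.Icc (-1 : ℝ) 1) : eta c y = 0 := by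
  rw [eta, chiStar_eq_zero isClosed_Icc hy, zero_mul, zero_mul]

theorem measurable_eta : Measurable (eta c) :=
  ((measurable_chiStar _).mul measurable_const).mul (measurable_besselI0.comp (by fun_prop))

theorem integrable_of_bounded_of_eq_zero {f : ℝ → ℝ} (hf : Measurable f) {C a b : ℝ}
    (hC : ∀ y, |f y| ≤ C) (h0 : ∀ y, y ∉ Set.Icc a b → f y = 0) : Integrable f := by
  refine (integrableOn_iff_integrable_of_support_subset
    (Function.support_subset_iff'.2 h0)).1 ?_
  exact Measure.integrableOn_of_bounded (M := C) (by simp) hf.aestronglyMeasurable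
    (Filter.Eventually.of_forall hC)

theorem integrable_eta : Integrable (eta c) :=
  integrable_of_bounded_of_eq_zero (measurable_eta c)
    (fun y => (abs_of_nonneg (eta_nonneg c y)).trans_le (eta_le c y)) fun _ => eta_eq_zero c

/-- The distribution function of `η_c`, so that `μ_c(t) = etaCdf c (-t)` for `t > 0`. -/
def etaCdf (t : ℝ) : ℝ := ∫ τ in Set.Iic t, eta c τ

theorem etaCdf_nonneg (t : ℝ) : 0 ≤ etaCdf c t :=
  setIntegral_nonneg measurableSet_Iic fun y _ => eta_nonneg c y

theorem etaCdf_le_integral (t : ℝ) : etaCdf c t ≤ ∫ y, eta c y :=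
  setIntegral_le_integral (integrable_eta c) (Filter.Eventually.of_forall (eta_nonneg c))

theorem monotone_etaCdf : Monotone (etaCdf c) := fun _ _ h =>
  setIntegral_mono_set (integrable_eta c).integrableOn
    (Filter.Eventually.of_forall (eta_nonneg c)) (Set.Iic_subset_Iic.2 h).eventuallyLE

theorem etaCdf_eq_zero (ht : t ≤ -1) : etaCdf c t = 0 := by
  rw [etaCdf, integral_Iic_eq_integral_Iio]
  exact setIntegral_eq_zero_of_forall_eq_zero fun y hy =>
    eta_eq_zero c fun h => (lt_of_lt_of_le hy ht).not_ge h.1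

theorem setIntegral_Iic_comp_div (hε : 0 < ε) (f : ℝ → ℝ) (t : ℝ) :
    ∫ τ in Set.Iic t, f (τ / ε) = ε * ∫ τ in Set.Iic (t / ε), f τ := by
  have h := Measure.integral_comp_div ((Set.Iic (t / ε)).indicator f) ε
  rw [abs_of_pos hε, smul_eq_mul] at h
  rw [← integral_indicator measurableSet_Iic, ← integral_indicator measurableSet_Iic, ← h]
  congr 1
  ext τ
  simp only [Set.indicator, Set.mem_Iic, div_le_div_iff_of_pos_right hε]

theorem muEps_eq_ite (hε : 0 < ε) (t : ℝ) :
    muEps c ε t = if t < 0 then -etaCdf c (t / ε) else if 0 < t then etaCdf c (-t / ε) else 0 := by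
  have hcdf : ∀ s, ∫ τ in Set.Iic s, etaEps c ε τ = etaCdf c (s / ε) := fun s => by
    simp only [etaEps]
    rw [integral_const_mul, setIntegral_Iic_comp_div hε, etaCdf]
    field_simp
  simp only [muEps, hcdf]

theorem mu_eq_ite (t : ℝ) :
    mu c t = if t < 0 then -etaCdf c t else if 0 < t then etaCdf c (-t) else 0 := by
  rw [mu, muEps_eq_ite c one_pos, div_one, div_one]

theorem muEps_eq_mu (hε : 0 < ε) (t : ℝ) : muEps c ε t = mu c (t / ε) := by
  rw [muEps_eq_ite c hε, mu_eq_ite, neg_div]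
  simp only [div_neg_iff, div_pos_iff, hε, hε.not_gt, and_true, and_false, or_false, false_or]

theorem nuEps_eq_nu (hε : 0 < ε) (t : ℝ) : nuEps c ε t = ε * nu c (t / ε) := by
  simp only [nuEps, nu, muEps_eq_mu c hε]
  rw [setIntegral_Iic_comp_div hε]
  rfl

theorem mu_of_pos (ht : 0 < t) : mu c t = etaCdf c (-t) := by
  rw [mu_eq_ite, if_neg ht.not_gt, if_pos ht]

theorem mu_neg (t : ℝ) : mu c (-t) = -mu c t := by
  rw [mu_eq_ite, mu_eq_ite, neg_neg]
  rcases lt_trichotomy t 0 with h | rfl | h <;> simp [*, not_lt_of_gt]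

theorem mu_nonneg (ht : 0 < t) : 0 ≤ mu c t := by
  rw [mu_of_pos c ht]
  exact etaCdf_nonneg c _

theorem abs_mu (ht : t ≠ 0) : |mu c t| = mu c |t| := by
  rcases ht.lt_or_gt with h | h
  · rw [abs_of_neg h, mu_neg, ← abs_neg, ← mu_neg, abs_of_nonneg (mu_nonneg c (neg_pos.2 h))]
  · rw [abs_of_pos h, abs_of_nonneg (mu_nonneg c h)]

theorem mu_eq_zero (ht : 1 ≤ t) : mu c t = 0 := by
  rw [mu_of_pos c (by linarith), etaCdf_eq_zero c (by linarith)]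

theorem antitoneOn_mu : AntitoneOn (mu c) (Set.Ioi 0) := fun s hs t ht hst => by
  rw [mu_of_pos c hs, mu_of_pos c ht]
  exact monotone_etaCdf c (neg_le_neg hst)

theorem measurable_mu : Measurable (mu c) := by
  rw [funext (mu_eq_ite c)]
  have h := (monotone_etaCdf c).measurable
  exact Measurable.ite measurableSet_Iio h.neg
    (Measurable.ite measurableSet_Ioi (h.comp measurable_neg) measurable_const)

theorem integrable_mu : Integrable (mu c) := by
  have habs : ∀ t, |etaCdf c t| ≤ ∫ y, eta c y := fun t =>
    (abs_of_nonneg (etaCdf_nonneg c t)).trans_le (etaCdf_le_integral c t)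
  refine integrable_of_bounded_of_eq_zero (measurable_mu c) (C := ∫ y, eta c y) (a := -1) (b := 1)
    (fun t => ?_) fun t ht => ?_
  · rw [mu_eq_ite]
    split_ifs
    · rw [abs_neg]
      exact habs _
    · exact habs _
    · rw [abs_zero]
      exact (abs_nonneg _).trans (habs 0)
  · rw [Set.mem_Icc, not_and_or, not_le, not_le] at ht
    rcases ht with ht | ht
    · rw [← neg_neg t, mu_neg, mu_eq_zero c (by linarith), neg_zero]
    · exact mu_eq_zero c ht.le

theorem nu_eq_setIntegral (u : ℝ) : nu c u = ∫ t in Set.Iic u, mu c t := rfl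

theorem nu_neg (u : ℝ) : nu c (-u) = nu c u := by
  have hodd : ∫ t in -u..u, mu c t = 0 := by
    have h := intervalIntegral.integral_comp_neg (a := -u) (b := u) (mu c)
    simp only [mu_neg, neg_neg, intervalIntegral.integral_neg] at h
    linarith
  rw [nu_eq_setIntegral, nu_eq_setIntegral, eq_comm, ← sub_eq_zero, ← hodd]
  exact intervalIntegral.integral_Iic_sub_Iic (integrable_mu c).integrableOn
    (integrable_mu c).integrableOn

theorem nu_abs (u : ℝ) : nu c |u| = nu c u := by
  rcases abs_choice u with h | h <;> rw [h]
  exact nu_neg c u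

theorem nu_eq_neg_integral (hu1 : u ≤ 1) : nu c u = -∫ t in u..1, mu c t := by
  have hreflect : ∫ t in Set.Iic (-u), mu c t = -∫ t in Set.Ioi u, mu c t := by
    rw [← neg_neg u, ← integral_comp_neg_Iic, neg_neg, ← integral_neg]
    simp only [mu_neg, neg_neg]
  have hint := (integrable_mu c).integrableOn (s := Set.Ioi 1)
  rw [← nu_neg, nu_eq_setIntegral, hreflect, ← Set.Ioc_union_Ioi_eq_Ioi hu1,
    setIntegral_union (Set.Ioc_disjoint_Ioi le_rfl) measurableSet_Ioi
      (integrable_mu c).integrableOn hint,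
    setIntegral_eq_zero_of_forall_eq_zero (t := Set.Ioi (1 : ℝ)) fun t ht => mu_eq_zero c ht.le,
    add_zero, intervalIntegral.integral_of_le hu1]

theorem abs_nu_eq_integral (hu : 0 < u) (hu1 : u ≤ 1) : |nu c u| = ∫ t in u..1, mu c t := by
  rw [nu_eq_neg_integral c hu1, abs_neg, abs_of_nonneg]
  exact intervalIntegral.integral_nonneg hu1 fun t ht => mu_nonneg c (hu.trans_le ht.1)

theorem abs_nu_le (hu : 0 < u) (hu1 : u ≤ 1) : |nu c u| ≤ (1 - u) * mu c u := by
  rw [abs_nu_eq_integral c hu hu1]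
  have h := intervalIntegral.integral_mono_on hu1 (integrable_mu c).intervalIntegrable
    intervalIntegrable_const fun t ht => antitoneOn_mu c hu (hu.trans_le ht.1) ht.1
  rwa [intervalIntegral.integral_const, smul_eq_mul] at h

variable {c}

theorem convexOn_sinh : ConvexOn ℝ (Set.Ici 0) Real.sinh := by
  refine MonotoneOn.convexOn_of_deriv (convex_Ici 0) Real.continuous_sinh.continuousOn
    Real.differentiable_sinh.differentiableOn ?_
  rw [Real.deriv_sinh, interior_Ici]
  exact Real.cosh_strictMonoOn.monotoneOn.mono Set.Ioi_subset_Ici_self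

theorem one_le_lam (hc : c ≠ 0) (ε : ℝ) : 1 ≤ lam c ε := by
  rw [lam, logan_half_I c ε hc, Complex.ofReal_re]
  set s := √(c ^ 2 + ε ^ 2 / 4)
  have heven : c / Real.sinh c = |c| / Real.sinh |c| := by
    rcases abs_choice c with h | h <;> rw [h]
    rw [Real.sinh_neg, neg_div_neg_eq]
  have hc0 : 0 < |c| := abs_pos.2 hc
  have hcs : |c| ≤ s := Real.abs_le_sqrt (by nlinarith)
  have hs0 : 0 < s := hc0.trans_le hcs
  have := Real.sinh_pos_iff.2 hc0
  have hsecant := convexOn_sinh.secant_mono (Set.mem_Ici.2 le_rfl) hc0.le hs0.le hc0.ne' hs0.ne' hcs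
  rw [Real.sinh_zero, sub_zero, sub_zero, sub_zero, sub_zero] at hsecant
  calc (1 : ℝ) = |c| / Real.sinh |c| * (Real.sinh |c| / |c|) := by field_simp
    _ ≤ |c| / Real.sinh |c| * (Real.sinh s / s) := by gcongr
    _ = _ := by rw [heven]

theorem abs_one_div_log_sub_half_le (ht : 2 ≤ t) : |1 / Real.log t - 1 / 2| ≤ 1 := by
  have hlog : 2 / 3 ≤ Real.log t :=
    (by linarith [Real.log_two_gt_d9] : 2 / 3 ≤ Real.log 2).trans (Real.log_le_log two_pos ht)
  have hinv : 1 / Real.log t ≤ 1 / (2 / 3) := one_div_le_one_div_of_le (by norm_num) hlog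
  have hpos : 0 < 1 / Real.log t := by positivity
  rw [abs_le]
  constructor <;> linarith

theorem abs_weightM_le {x : ℝ} (hc : c ≠ 0) (hε : 0 < ε) (ht : 2 ≤ t) (hu : 0 < u) (hu1 : u ≤ 1)
    (htu : |Real.log (t / x)| = ε * u) : |weightM x c ε t| ≤ Real.exp ε * mu c u := by
  rw [weightM, muEps_eq_mu c hε, nuEps_eq_nu c hε]
  set s := Real.log (t / x)
  have hsu : |s / ε| = u := by rw [abs_div, abs_of_pos hε, htu, mul_div_cancel_left₀ _ hε.ne']
  have hmu : |mu c (s / ε)| = mu c u := by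
    rw [abs_mu c (abs_pos.1 (hsu ▸ hu)), hsu]
  have hinner : |mu c (s / ε) * s - ε * nu c (s / ε)| ≤ ε * mu c u := calc
    _ ≤ mu c u * (ε * u) + ε * |nu c u| := by
      refine (abs_sub _ _).trans_eq ?_
      rw [abs_mul, abs_mul, hmu, htu, abs_of_pos hε, ← nu_abs, hsu]
    _ ≤ mu c u * (ε * u) + ε * ((1 - u) * mu c u) := by
      gcongr
      exact abs_nu_le c hu hu1
    _ = ε * mu c u := by ring
  have hlam := one_le_lam hc ε
  rw [abs_mul, abs_of_pos (inv_pos.2 (by linarith))]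
  calc _ ≤ |mu c (s / ε) + (1 / Real.log t - 1 / 2) * (mu c (s / ε) * s - ε * nu c (s / ε))| :=
        mul_le_of_le_one_left (abs_nonneg _) (inv_le_one_of_one_le₀ hlam)
    _ ≤ mu c u + 1 * (ε * mu c u) := by
      refine (abs_add_le _ _).trans ?_
      rw [hmu, abs_mul]
      gcongr
      exact abs_one_div_log_sub_half_le ht
    _ = (ε + 1) * mu c u := by ring
    _ ≤ Real.exp ε * mu c u :=
      mul_le_mul_of_nonneg_right (Real.add_one_le_exp ε) (mu_nonneg c hu)

end Kernel

section Shell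

open Finset

/-- The parametrisation `u ↦ x e^{δu}` by `[α, 1]` of the outer intervals: of `I_α⁺` for `δ = ε`
and of `I_α⁻` for `δ = -ε`. -/
def shell (x δ u : ℝ) : ℝ := x * Real.exp (δ * u)

/-- The kernel `μ_c` transported along the parametrisation `shell x δ`. -/
def shellWeight (c x δ t : ℝ) : ℝ := mu c (Real.log (t / x) / δ)

variable {x δ ε α u v c a U t : ℝ}

theorem continuous_shell (x δ : ℝ) : Continuous (shell x δ) := by
  unfold shell
  fun_prop

theorem hasDerivAt_shell (x δ u : ℝ) : HasDerivAt (shell x δ) (δ * shell x δ u) u := by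
  convert! ((hasDerivAt_id u).const_mul δ).exp.const_mul x using 1
  simp only [shell, id_eq]
  ring

theorem shell_pos (hx : 0 < x) (δ u : ℝ) : 0 < shell x δ u := by
  unfold shell
  positivity

theorem shell_le_shell_iff (hx : 0 < x) : shell x δ u ≤ shell x δ v ↔ δ * u ≤ δ * v := by
  rw [shell, shell, mul_le_mul_iff_right₀ hx, Real.exp_le_exp]

theorem outerPlus_eq_image_shell (hx : 0 < x) (hε : 0 ≤ ε) (hα1 : α ≤ 1) :
    outerPlus x ε α = shell x ε '' Set.Icc α 1 := by
  rw [(continuous_shell x ε).continuousOn.image_Icc_of_monotoneOn hα1 fun u _ v _ huv =>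
    (shell_le_shell_iff hx).2 (mul_le_mul_of_nonneg_left huv hε)]
  simp only [outerPlus, shell, mul_comm, mul_one]

theorem outerMinus_eq_image_shell (hx : 0 < x) (hε : 0 ≤ ε) (hα1 : α ≤ 1) :
    outerMinus x ε α = shell x (-ε) '' Set.Icc α 1 := by
  rw [(continuous_shell x (-ε)).continuousOn.image_Icc_of_antitoneOn hα1 fun u _ v _ huv =>
    (shell_le_shell_iff hx).2 (mul_le_mul_of_nonpos_left huv (neg_nonpos.2 hε))]
  simp only [outerMinus, shell, mul_comm x, mul_one, neg_mul, mul_comm ε]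

theorem shell_le_exp_mul_shell (hx : 0 < x) (hu : u ∈ Set.Icc 0 1) (hv : v ∈ Set.Icc 0 1) :
    shell x δ v ≤ Real.exp |δ| * shell x δ u := by
  have hdist : |v - u| ≤ 1 := by
    rw [abs_le]
    constructor <;> linarith [hu.1, hu.2, hv.1, hv.2]
  have hexp : δ * v ≤ |δ| + δ * u := by
    have h := (le_abs_self (δ * (v - u))).trans_eq (abs_mul _ _)
    have h' := mul_le_of_le_one_right (abs_nonneg δ) hdist
    linarith
  calc shell x δ v ≤ x * Real.exp (|δ| + δ * u) :=
        mul_le_mul_of_nonneg_left (Real.exp_le_exp.2 hexp) hx.le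
    _ = Real.exp |δ| * shell x δ u := by
      rw [shell, Real.exp_add]
      ring

theorem shell_zero (x δ : ℝ) : shell x δ 0 = x := by
  rw [shell, mul_zero, Real.exp_zero, mul_one]

theorem shell_le_mul_exp (hx : 0 < x) (hu : u ∈ Set.Icc 0 1) : shell x δ u ≤ x * Real.exp |δ| := by
  have h := shell_le_exp_mul_shell (δ := δ) hx (Set.left_mem_Icc.2 zero_le_one) hu
  rwa [shell_zero, mul_comm] at h

theorem mul_exp_neg_le_shell (hx : 0 < x) (hu : u ∈ Set.Icc 0 1) :
    x * Real.exp (-|δ|) ≤ shell x δ u := by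
  have h := shell_le_exp_mul_shell (δ := δ) hx hu (Set.left_mem_Icc.2 zero_le_one)
  rwa [shell_zero, mul_comm, ← div_le_iff₀ (Real.exp_pos _), div_eq_mul_inv, ← Real.exp_neg] at h

theorem log_shell_div (hx : 0 < x) : Real.log (shell x δ u / x) = δ * u := by
  rw [shell, mul_div_cancel_left₀ _ hx.ne', Real.log_exp]

theorem shellWeight_shell (hx : 0 < x) (hδ : δ ≠ 0) : shellWeight c x δ (shell x δ u) = mu c u := by
  rw [shellWeight, log_shell_div hx, mul_div_cancel_left₀ _ hδ]

theorem shellWeight_mem_Icc (hx : 0 < x) (hδ : δ ≠ 0) (hα : 0 < α)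
    (ht : t ∈ shell x δ '' Set.Icc α 1) : shellWeight c x δ t ∈ Set.Icc 0 (mu c α) := by
  obtain ⟨u, hu, rfl⟩ := ht
  rw [shellWeight_shell hx hδ]
  exact ⟨mu_nonneg c (hα.trans_le hu.1), antitoneOn_mu c hα (hα.trans_le hu.1) hu.1⟩

theorem monotoneOn_or_antitoneOn_shellWeight (hx : 0 < x) (hδ : δ ≠ 0) (hα : 0 < α) :
    MonotoneOn (shellWeight c x δ) (shell x δ '' Set.Icc α 1) ∨
      AntitoneOn (shellWeight c x δ) (shell x δ '' Set.Icc α 1) := by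
  refine hδ.lt_or_gt.imp (fun h => ?_) fun h => ?_ <;>
    rintro _ ⟨u, hu, rfl⟩ _ ⟨v, hv, rfl⟩ huv <;>
    rw [shell_le_shell_iff hx] at huv <;>
    rw [shellWeight_shell hx hδ, shellWeight_shell hx hδ]
  · exact antitoneOn_mu c (hα.trans_le hv.1) (hα.trans_le hu.1) ((mul_le_mul_left_of_neg h).1 huv)
  · exact antitoneOn_mu c (hα.trans_le hu.1) (hα.trans_le hv.1) ((mul_le_mul_iff_right₀ h).1 huv)

theorem setIntegral_shellWeight_le (hx : 0 < x) (hδ : δ ≠ 0) (hα : 0 < α) (hα1 : α ≤ 1) :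
    ∫ t in shell x δ '' Set.Icc α 1, shellWeight c x δ t ≤
      |δ| * x * Real.exp |δ| * |nu c α| := by
  have hinj : Set.InjOn (shell x δ) (Set.Icc α 1) := fun u _ v _ huv =>
    mul_left_cancel₀ hδ (Real.exp_injective (mul_left_cancel₀ hx.ne' huv))
  have hle : ∀ u ∈ Set.Icc α 1, |δ * shell x δ u| • shellWeight c x δ (shell x δ u) ≤
      |δ| * (x * Real.exp |δ|) * mu c u := fun u hu => by
    rw [shellWeight_shell hx hδ, abs_mul, abs_of_pos (shell_pos hx δ u), smul_eq_mul]
    have := mu_nonneg c (hα.trans_le hu.1)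
    gcongr
    exact shell_le_mul_exp hx ⟨hα.le.trans hu.1, hu.2⟩
  rw [integral_image_eq_integral_abs_deriv_smul measurableSet_Icc
    (fun u _ => (hasDerivAt_shell x δ u).hasDerivWithinAt) hinj, abs_nu_eq_integral c hα hα1,
    intervalIntegral.integral_of_le hα1, ← integral_Icc_eq_integral_Ioc, ← integral_const_mul]
  simp only [← mul_assoc] at hle
  refine integral_mono_of_nonneg ?_ ((integrable_mu c).const_mul _).integrableOn ?_
  · filter_upwards [ae_restrict_mem measurableSet_Icc] with u hu
    rw [shellWeight_shell hx hδ]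
    exact smul_nonneg (abs_nonneg _) (mu_nonneg c (hα.trans_le hu.1))
  · filter_upwards [ae_restrict_mem measurableSet_Icc] with u hu using hle u hu

theorem coprime_six_of_prime {p : ℕ} (hp : p.Prime) (h3 : 3 < p) : p.Coprime 6 := by
  rw [show 6 = 2 * 3 by rfl, Nat.coprime_mul_iff_right, Nat.coprime_primes hp Nat.prime_two,
    Nat.coprime_primes hp Nat.prime_three]
  lia

theorem sum_primes_shellWeight_le {z : ℕ} (hx : 0 < x) (hδ : δ ≠ 0) (hα : 0 < α) (hα1 : α ≤ 1)
    (hI : Set.Icc a U = shell x δ '' Set.Icc α 1) (ha : 3 < a) (hz : 1 < z) (hza : z ≤ a) :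
    ∑ p ∈ Icc ⌈a⌉₊ ⌊U⌋₊ with p.Prime, shellWeight c x δ p ≤
      |δ| * x * Real.exp |δ| * |nu c α| / 3 / totientSum 6 z +
        2 * mu c α * (sigmaTotientSum 6 z / totientSum 6 z) ^ 2 := by
  have haU : a ≤ U := Set.nonempty_Icc.1 (hI ▸ (Set.nonempty_Icc.2 hα1).image _)
  have hL := totientSum_pos (k := 6) hz
  have hint : ∫ t in a..U, shellWeight c x δ t ≤ |δ| * x * Real.exp |δ| * |nu c α| := by
    rw [intervalIntegral.integral_of_le haU, ← integral_Icc_eq_integral_Ioc, hI]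
    exact setIntegral_shellWeight_le hx hδ hα hα1
  have htot : Nat.totient 6 = 2 := by decide
  refine (sum_primes_Icc_le_selberg (k := 6) (by norm_num) hz (by linarith) haU hza
    (fun p hp hap => coprime_six_of_prime hp (by exact_mod_cast ha.trans_le hap))
    (hI ▸ monotoneOn_or_antitoneOn_shellWeight hx hδ hα)
    fun t ht => shellWeight_mem_Icc hx hδ hα (hI ▸ ht)).trans ?_
  rw [htot, Nat.cast_ofNat, Nat.cast_ofNat]
  gcongr
  linarith

theorem abs_weightM_le_shellWeight (hx : 0 < x) (hc : c ≠ 0) (hδ : δ ≠ 0) (hα : 0 < α)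
    (ht2 : 2 ≤ t) (ht : t ∈ shell x δ '' Set.Icc α 1) :
    |weightM x c |δ| t| ≤ Real.exp |δ| * shellWeight c x δ t := by
  obtain ⟨u, hu, rfl⟩ := ht
  have hu0 := hα.trans_le hu.1
  rw [shellWeight_shell hx hδ]
  refine abs_weightM_le hc (abs_pos.2 hδ) ht2 hu0 hu.2 ?_
  rw [log_shell_div hx, abs_mul, abs_of_pos hu0]

end Shell

section HigherPowers

open Finset

theorem sum_inv_Icc_two_le_log {M : ℕ} (hM : 1 ≤ M) :
    ∑ m ∈ Icc 2 M, 1 / (m : ℝ) ≤ Real.log M := by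
  induction M, hM using Nat.le_induction with
  | base => simp
  | succ M hM ih =>
    have hM0 : (0 : ℝ) < M := by exact_mod_cast hM
    have hlog := Real.one_sub_inv_le_log_of_pos (show (0 : ℝ) < (M + 1 : ℕ) / M by positivity)
    rw [Real.log_div (by positivity) hM0.ne'] at hlog
    have hinv : 1 - (((M + 1 : ℕ) : ℝ) / M)⁻¹ = 1 / (M + 1 : ℕ) := by
      push_cast
      field_simp
      ring
    rw [sum_Icc_succ_top (by lia)]
    linarith

theorem sum_inv_sq_Icc_two_le {M : ℕ} (hM : 1 ≤ M) :
    ∑ m ∈ Icc 2 M, 1 / (m : ℝ) ^ 2 ≤ 1 - 1 / (M : ℝ) := by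
  induction M, hM using Nat.le_induction with
  | base => simp
  | succ M hM ih =>
    have hM0 : (0 : ℝ) < M := by exact_mod_cast hM
    have htelescope : 1 / ((M + 1 : ℕ) : ℝ) ^ 2 ≤ 1 / M - 1 / (M + 1 : ℕ) := by
      push_cast
      rw [div_sub_div _ _ hM0.ne' (by positivity), div_le_div_iff₀ (by positivity) (by positivity)]
      nlinarith
    rw [sum_Icc_succ_top (by lia)]
    linarith

theorem card_le_max'_sub_min'_add_one {s : Finset ℕ} (hs : s.Nonempty) :
    (#s : ℝ) ≤ (s.max' hs : ℝ) - s.min' hs + 1 := by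
  have hcard : #s ≤ s.max' hs + 1 - s.min' hs := by
    rw [← Nat.card_Icc]
    exact card_le_card fun n hn => mem_Icc.2 ⟨s.min'_le n hn, s.le_max' n hn⟩
  have hle := s.min'_le _ (s.max'_mem hs)
  have : #s + s.min' hs ≤ s.max' hs + 1 := by lia
  have : (#s : ℝ) + s.min' hs ≤ s.max' hs + 1 := by exact_mod_cast this
  linarith

theorem sub_le_mul_div_of_pow_le {a b δ : ℝ} {m : ℕ} (hm : 0 < m) (ha : 0 < a) (hb : 0 ≤ b)
    (h : b ^ m ≤ (1 + δ) * a ^ m) : b - a ≤ δ * a / m := by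
  have hbern := one_add_mul_sub_le_pow (a := b / a) (by linarith [div_nonneg hb ha.le]) m
  rw [div_pow] at hbern
  have hdiv := (div_le_iff₀ (pow_pos ha m)).2 h
  have hba : b / a = (b - a) / a + 1 := by field_simp; ring
  rw [hba, add_sub_cancel_right, mul_div_assoc'] at hbern
  have hmul : m * (b - a) / a ≤ δ := by linarith
  rw [div_le_iff₀ ha] at hmul
  rw [le_div_iff₀ (by positivity)]
  linarith

theorem card_le_of_pow_mem {s : Finset ℕ} {m : ℕ} {δ r : ℝ} (hm : 2 ≤ m) (hδ : 0 ≤ δ)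
    (hpos : ∀ n ∈ s, 1 ≤ n) (hratio : ∀ n ∈ s, ∀ k ∈ s, (k : ℝ) ^ m ≤ (1 + δ) * (n : ℝ) ^ m)
    (hr : ∀ n ∈ s, (n : ℝ) ^ m ≤ r) : (#s : ℝ) ≤ 1 + δ * √r / m := by
  rcases s.eq_empty_or_nonempty with rfl | hs
  · rw [card_empty, Nat.cast_zero]
    positivity
  have hmin := s.min'_mem hs
  have hone : (1 : ℝ) ≤ s.min' hs := by exact_mod_cast hpos _ hmin
  have hsqrt : (s.min' hs : ℝ) ≤ √r :=
    Real.le_sqrt_of_sq_le ((pow_le_pow_right₀ hone hm).trans (hr _ hmin))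
  have hdiff := sub_le_mul_div_of_pow_le (by lia) (zero_lt_one.trans_le hone)
    (Nat.cast_nonneg _) (hratio _ hmin _ (s.max'_mem hs))
  calc (#s : ℝ) ≤ (s.max' hs : ℝ) - s.min' hs + 1 := card_le_max'_sub_min'_add_one hs
    _ ≤ δ * s.min' hs / m + 1 := by gcongr
    _ ≤ δ * √r / m + 1 := by gcongr
    _ = _ := add_comm _ _

theorem card_fiber_le {T : Finset (ℕ × ℕ)} {m : ℕ} {δ r : ℝ} (hm : 2 ≤ m) (hδ : 0 ≤ δ)
    (hpos : ∀ q ∈ T, 1 ≤ q.1) (hr : ∀ q ∈ T, (q.1 : ℝ) ^ q.2 ≤ r)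
    (hratio : ∀ q ∈ T, ∀ q' ∈ T, (q'.1 : ℝ) ^ q'.2 ≤ (1 + δ) * (q.1 : ℝ) ^ q.2) :
    (#{q ∈ T | q.2 = m} : ℝ) ≤ 1 + δ * √r / m := by
  have hinj : Set.InjOn Prod.fst (SetLike.coe {q ∈ T | q.2 = m}) := fun q hq q' hq' h =>
    Prod.ext h ((mem_filter.1 hq).2.trans (mem_filter.1 hq').2.symm)
  have hmem : ∀ n ∈ {q ∈ T | q.2 = m}.image Prod.fst, (n, m) ∈ T := by
    intro n hn
    obtain ⟨⟨n, _⟩, hq, rfl⟩ := mem_image.1 hn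
    obtain ⟨hqT, rfl⟩ := mem_filter.1 hq
    exact hqT
  rw [← card_image_of_injOn hinj]
  exact card_le_of_pow_mem hm hδ (fun n hn => hpos _ (hmem n hn))
    (fun n hn k hk => hratio _ (hmem n hn) _ (hmem k hk)) fun n hn => hr _ (hmem n hn)

theorem sum_one_div_exponent_le {T : Finset (ℕ × ℕ)} {M : ℕ} {δ r : ℝ} (hδ : 0 ≤ δ) (hM : 1 ≤ M)
    (hexp : ∀ q ∈ T, q.2 ∈ Icc 2 M) (hpos : ∀ q ∈ T, 1 ≤ q.1)
    (hr : ∀ q ∈ T, (q.1 : ℝ) ^ q.2 ≤ r)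
    (hratio : ∀ q ∈ T, ∀ q' ∈ T, (q'.1 : ℝ) ^ q'.2 ≤ (1 + δ) * (q.1 : ℝ) ^ q.2) :
    ∑ q ∈ T, 1 / (q.2 : ℝ) ≤ Real.log M + δ * √r := by
  have hfiber : ∀ m ∈ Icc 2 M, ∑ q ∈ T with q.2 = m, 1 / (q.2 : ℝ) ≤
      1 / (m : ℝ) + δ * √r * (1 / (m : ℝ) ^ 2) := fun m hm => calc
    _ = #{q ∈ T | q.2 = m} * (1 / (m : ℝ)) := by
      rw [← nsmul_eq_mul]
      exact sum_eq_card_nsmul fun q hq => by rw [(mem_filter.1 hq).2]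
    _ ≤ (1 + δ * √r / m) * (1 / (m : ℝ)) := by
      gcongr
      exact card_fiber_le (mem_Icc.1 hm).1 hδ hpos hr hratio
    _ = _ := by
      have : m ≠ 0 := by linarith [(mem_Icc.1 hm).1]
      field_simp
  rw [← sum_fiberwise_of_maps_to hexp]
  refine (sum_le_sum hfiber).trans ?_
  rw [sum_add_distrib, ← mul_sum]
  have hsq : ∑ m ∈ Icc 2 M, 1 / (m : ℝ) ^ 2 ≤ 1 :=
    (sum_inv_sq_Icc_two_le hM).trans (sub_le_self _ (by positivity))
  exact add_le_add (sum_inv_Icc_two_le_log hM) (mul_le_of_le_one_right (by positivity) hsq)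

end HigherPowers

section OuterIntervals

open Finset

variable {x ε δ c α a U : ℝ}

theorem mu_pos_of_one_lt_sieveB (hα : 0 < α) (hB : 1 < sieveB x c ε α) : 0 < mu c α := by
  refine (mu_nonneg c hα).lt_of_ne' fun h => ?_
  rw [sieveB, h, mul_zero, div_zero] at hB
  linarith

theorem ne_zero_of_one_lt_sieveB (hα : 0 < α) (hB : 1 < sieveB x c ε α) : c ≠ 0 := by
  rintro rfl
  have hmu : mu 0 α = 0 := by simp [mu_of_pos, hα, etaCdf, eta]
  exact (mu_pos_of_one_lt_sieveB hα hB).ne' hmu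

theorem lt_one_of_one_lt_sieveB (hα : 0 < α) (hB : 1 < sieveB x c ε α) : α < 1 := by
  by_contra! h
  exact (mu_pos_of_one_lt_sieveB hα hB).ne' (mu_eq_zero c h)

theorem eps_pos_of_one_lt_sieveB (hx : 0 < x) (hα : 0 < α) (hB : 1 < sieveB x c ε α) : 0 < ε := by
  have hmu := mu_pos_of_one_lt_sieveB hα hB
  rw [sieveB, lt_div_iff₀ (by positivity)] at hB
  by_contra! h
  have := mul_nonneg (mul_nonneg hx.le (Real.exp_nonneg (-ε))) (abs_nonneg (nu c α))
  nlinarith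

theorem sieveB_le (hx : 0 < x) (hα : 0 < α) (hB : 1 < sieveB x c ε α) :
    sieveB x c ε α ≤ ε / 2 * (x * Real.exp (-ε)) := by
  have hmu := mu_pos_of_one_lt_sieveB hα hB
  have hε := eps_pos_of_one_lt_sieveB hx hα hB
  have hnu : |nu c α| ≤ mu c α := (abs_nu_le c hα (lt_one_of_one_lt_sieveB hα hB).le).trans
    (mul_le_of_le_one_left hmu.le (by linarith))
  rw [sieveB, div_le_iff₀ (by positivity)]
  calc ε * x * Real.exp (-ε) * |nu c α| ≤ ε * x * Real.exp (-ε) * mu c α := by gcongr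
    _ = ε / 2 * (x * Real.exp (-ε)) * (2 * mu c α) := by ring

theorem three_lt_of_one_lt_sieveB (hx : 0 < x) (hε : ε ≤ 2 / 3) (hα : 0 < α)
    (hB : 1 < sieveB x c ε α) : 3 < x * Real.exp (-ε) := by
  have := hB.trans_le (sieveB_le hx hα hB)
  nlinarith [mul_pos hx (Real.exp_pos (-ε))]

theorem sum_primes_shellWeight_le_div_log (hx : 0 < x) (hε : ε ≤ 2 / 3) (hα : 0 < α)
    (hB : 1 < sieveB x c ε α) (hδ : |δ| = ε) (hI : Set.Icc a U = shell x δ '' Set.Icc α 1)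
    (ha : x * Real.exp (-ε) ≤ a) :
    ∑ p ∈ Icc ⌈a⌉₊ ⌊U⌋₊ with p.Prime, shellWeight c x δ p ≤
      2 * ε * x * Real.exp ε * |nu c α| / Real.log (sieveB x c ε α) := by
  have hmu := mu_pos_of_one_lt_sieveB hα hB
  have hε0 := eps_pos_of_one_lt_sieveB hx hα hB
  have hα1 := (lt_one_of_one_lt_sieveB hα hB).le
  have h3 := three_lt_of_one_lt_sieveB hx hε hα hB
  obtain ⟨z, hz, hzB, hlevel⟩ := exists_sieve_level hB
  have hza : (z : ℝ) ≤ a := by nlinarith [sieveB_le hx hα hB]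
  have hδ0 : δ ≠ 0 := abs_pos.1 (hδ ▸ hε0)
  set X := ε * x * Real.exp ε * |nu c α| / mu c α with hX
  have hmuX : mu c α * X = ε * x * Real.exp ε * |nu c α| := mul_div_cancel₀ _ hmu.ne'
  have hBX : 2 * sieveB x c ε α ≤ X := by
    have hexp : Real.exp (-ε) ≤ Real.exp ε := Real.exp_le_exp.2 (by linarith)
    calc 2 * sieveB x c ε α = ε * x * Real.exp (-ε) * |nu c α| / mu c α := by
          rw [sieveB]
          field_simp
      _ ≤ X := by rw [hX]; gcongr
  have hbound := sieve_bound_le (by linarith) hBX (Real.log_pos hB) (totientSum_pos hz) hlevel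
  have hsieve := sum_primes_shellWeight_le (c := c) hx hδ0 hα hα1 hI (by linarith) hz hza
  rw [hδ, ← hmuX] at hsieve
  calc ∑ p ∈ Icc ⌈a⌉₊ ⌊U⌋₊ with p.Prime, shellWeight c x δ p
      ≤ mu c α * (X / 3 / totientSum 6 z + 2 * (sigmaTotientSum 6 z / totientSum 6 z) ^ 2) := by
        refine hsieve.trans_eq ?_
        ring
    _ ≤ mu c α * (2 * X / Real.log (sieveB x c ε α)) := by gcongr
    _ = 2 * ε * x * Real.exp ε * |nu c α| / Real.log (sieveB x c ε α) := by
        rw [← mul_div_assoc, mul_left_comm, hmuX]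
        ring

/-- The proper prime powers in `I`, as pairs `(p, m)` with `m ≠ 1`; only for bounded `I`, since
`Set.Finite.toFinset` needs finiteness. -/
def properPrimePowers (I : Set ℝ) (hI : BddAbove I) : Finset (ℕ × ℕ) :=
  {q ∈ (primePowerPairs_finite hI).toFinset | q.2 ≠ 1}

theorem mem_properPrimePowers {I : Set ℝ} {hI : BddAbove I} {q : ℕ × ℕ} :
    q ∈ properPrimePowers I hI ↔ q.1.Prime ∧ 2 ≤ q.2 ∧ (q.1 : ℝ) ^ q.2 ∈ I := by
  simp only [properPrimePowers, mem_filter, Set.Finite.mem_toFinset, primePowerPairs,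
    Set.mem_ofPred_eq]
  lia

theorem primePowerSum_Icc (ha : 0 < a) (haU : a ≤ U) (F : ℝ → ℝ) :
    primePowerSum (Set.Icc a U) F = ∑ p ∈ Icc ⌈a⌉₊ ⌊U⌋₊ with p.Prime, F p +
      ∑ q ∈ properPrimePowers (Set.Icc a U) bddAbove_Icc,
        1 / (q.2 : ℝ) * F ((q.1 : ℝ) ^ q.2) := by
  rw [primePowerSum, finsum_mem_eq_finite_toFinset_sum _ (primePowerPairs_finite bddAbove_Icc),
    ← sum_filter_add_sum_filter_not _ (fun q : ℕ × ℕ => q.2 = 1)]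
  congr 1
  symm
  refine sum_bij (fun p _ => (p, 1)) (fun p hp => ?_) (fun p _ q _ h => (Prod.ext_iff.1 h).1)
    (fun q hq => ?_) (fun p _ => ?_)
  · rw [mem_filter, mem_Icc_ceil_floor ha haU] at hp
    simpa [primePowerPairs] using hp.symm
  · obtain ⟨p, m⟩ := q
    rw [mem_filter, Set.Finite.mem_toFinset] at hq
    obtain ⟨⟨hp, -, hI⟩, rfl : m = 1⟩ := hq
    rw [pow_one] at hI
    exact ⟨p, mem_filter.2 ⟨(mem_Icc_ceil_floor ha haU).2 hI, hp⟩, rfl⟩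
  · simp only [Nat.cast_one, div_one, one_mul, pow_one]

theorem abs_primePowerSum_le {I : Set ℝ} (hI : BddAbove I) {F G : ℝ → ℝ}
    (h : ∀ t ∈ I, |F t| ≤ G t) : |primePowerSum I F| ≤ primePowerSum I G := by
  rw [primePowerSum, primePowerSum,
    finsum_mem_eq_finite_toFinset_sum _ (primePowerPairs_finite hI),
    finsum_mem_eq_finite_toFinset_sum _ (primePowerPairs_finite hI)]
  refine (abs_sum_le_sum_abs _ _).trans (sum_le_sum fun q hq => ?_)
  rw [abs_mul, abs_of_nonneg (by positivity : (0 : ℝ) ≤ 1 / (q.2 : ℝ))]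
  gcongr
  exact h _ ((primePowerPairs_finite hI).mem_toFinset.1 hq).2.2

theorem exponent_le_log {p m : ℕ} (hp : 2 ≤ p) (hε : ε ≤ 1) (hx : 3 * Real.exp ε ≤ x)
    (h : (p : ℝ) ^ m ≤ x * Real.exp ε) : m ≤ Real.log (2 * x ^ 2) := by
  have hx0 : 0 < x := lt_of_lt_of_le (by positivity) hx
  have hlogx : 1 + ε ≤ Real.log x := by
    rw [Real.le_log_iff_exp_le hx0, Real.exp_add]
    exact (mul_le_mul_of_nonneg_right Real.exp_one_lt_three.le (Real.exp_nonneg ε)).trans hx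
  have hpow : m * Real.log 2 ≤ Real.log x + ε := by
    rw [← Real.log_pow, ← Real.log_exp ε, ← Real.log_mul hx0.ne' (Real.exp_ne_zero ε)]
    refine Real.log_le_log (by positivity) (le_trans ?_ h)
    gcongr
    exact_mod_cast hp
  have hlog2 := Real.log_two_gt_d9
  rw [Real.log_mul two_ne_zero (by positivity), Real.log_pow]
  push_cast
  nlinarith [m.cast_nonneg (α := ℝ)]

theorem sum_one_div_properPrimePowers_le {I : Set ℝ} (hI : BddAbove I) (hε : 0 ≤ ε)
    (hε' : ε ≤ 2 / 3) (hx : 3 * Real.exp ε ≤ x) (hle : ∀ t ∈ I, t ≤ x * Real.exp ε)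
    (hratio : ∀ t ∈ I, ∀ t' ∈ I, t' ≤ Real.exp ε * t) :
    ∑ q ∈ properPrimePowers I hI, 1 / (q.2 : ℝ) ≤
      4 * ε * √x + Real.log (Real.log (2 * x ^ 2)) := by
  have hexp : Real.exp ε ≤ 1 + 2 * ε := by
    have h := Real.abs_exp_sub_one_le (x := ε) (by rw [abs_of_nonneg hε]; linarith)
    rw [abs_of_nonneg hε] at h
    linarith [le_abs_self (Real.exp ε - 1)]
  have hx3 : 3 ≤ x := by linarith [Real.one_le_exp hε]
  have hlog : 1 ≤ Real.log (2 * x ^ 2) := by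
    rw [Real.le_log_iff_exp_le (by positivity)]
    nlinarith [Real.exp_one_lt_three]
  have hM : 1 ≤ ⌊Real.log (2 * x ^ 2)⌋₊ := Nat.le_floor (by exact_mod_cast hlog)
  have hsqrt : √(4 * x) = 2 * √x := by
    rw [Real.sqrt_mul zero_le_four, show (4 : ℝ) = 2 ^ 2 by norm_num, Real.sqrt_sq zero_le_two]
  calc ∑ q ∈ properPrimePowers I hI, 1 / (q.2 : ℝ)
      ≤ Real.log ⌊Real.log (2 * x ^ 2)⌋₊ + 2 * ε * √(4 * x) := by
        refine sum_one_div_exponent_le (by positivity) hM (fun q hq => ?_) (fun q hq => ?_)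
          (fun q hq => ?_) fun q hq q' hq' => ?_ <;>
          obtain ⟨hp, hm, hqI⟩ := mem_properPrimePowers.1 hq
        · exact mem_Icc.2
            ⟨hm, Nat.le_floor (exponent_le_log hp.two_le (by linarith) hx (hle _ hqI))⟩
        · exact hp.one_le
        · refine (hle _ hqI).trans ?_
          nlinarith
        · refine (hratio _ hqI _ (mem_properPrimePowers.1 hq').2.2).trans ?_
          gcongr
    _ ≤ Real.log (Real.log (2 * x ^ 2)) + 2 * ε * √(4 * x) := by
        gcongr
        exact Nat.floor_le (by linarith)
    _ = 4 * ε * √x + Real.log (Real.log (2 * x ^ 2)) := by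
        rw [hsqrt]
        ring

theorem sum_properPrimePowers_shellWeight_le (hx : 0 < x) (hε : ε ≤ 2 / 3) (hα : 0 < α)
    (hB : 1 < sieveB x c ε α) (hδ : |δ| = ε) (hI : Set.Icc a U = shell x δ '' Set.Icc α 1) :
    ∑ q ∈ properPrimePowers (Set.Icc a U) bddAbove_Icc,
        1 / (q.2 : ℝ) * shellWeight c x δ ((q.1 : ℝ) ^ q.2) ≤
      mu c α * (4 * ε * √x + Real.log (Real.log (2 * x ^ 2))) := by
  have hε0 := eps_pos_of_one_lt_sieveB hx hα hB
  have hδ0 : δ ≠ 0 := abs_pos.1 (hδ ▸ hε0)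
  have hmu := mu_pos_of_one_lt_sieveB hα hB
  have hx3 : 3 * Real.exp ε ≤ x := by
    have h := three_lt_of_one_lt_sieveB hx hε hα hB
    rw [Real.exp_neg, ← div_eq_mul_inv, lt_div_iff₀ (Real.exp_pos ε)] at h
    exact h.le
  have hmem : ∀ u ∈ Set.Icc α 1, u ∈ Set.Icc 0 1 := fun u hu => ⟨hα.le.trans hu.1, hu.2⟩
  have hle : ∀ t ∈ Set.Icc a U, t ≤ x * Real.exp ε := by
    rw [hI]
    rintro _ ⟨u, hu, rfl⟩
    exact hδ ▸ shell_le_mul_exp hx (hmem u hu)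
  have hratio : ∀ t ∈ Set.Icc a U, ∀ t' ∈ Set.Icc a U, t' ≤ Real.exp ε * t := by
    rw [hI]
    rintro _ ⟨u, hu, rfl⟩ _ ⟨v, hv, rfl⟩
    exact hδ ▸ shell_le_exp_mul_shell hx (hmem u hu) (hmem v hv)
  calc ∑ q ∈ properPrimePowers (Set.Icc a U) bddAbove_Icc,
        1 / (q.2 : ℝ) * shellWeight c x δ ((q.1 : ℝ) ^ q.2)
      ≤ ∑ q ∈ properPrimePowers (Set.Icc a U) bddAbove_Icc, mu c α * (1 / (q.2 : ℝ)) := by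
        refine sum_le_sum fun q hq => ?_
        rw [mul_comm (mu c α)]
        gcongr
        exact (shellWeight_mem_Icc hx hδ0 hα (hI ▸ (mem_properPrimePowers.1 hq).2.2)).2
    _ ≤ mu c α * (4 * ε * √x + Real.log (Real.log (2 * x ^ 2))) := by
        rw [← mul_sum]
        gcongr
        exact sum_one_div_properPrimePowers_le _ hε0.le hε
          hx3 hle hratio

theorem abs_primePowerSum_shell_le (hx : 0 < x) (hε : ε ≤ 2 / 3) (hα : 0 < α)
    (hB : 1 < sieveB x c ε α) (hδ : |δ| = ε) (hI : Set.Icc a U = shell x δ '' Set.Icc α 1) :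
    |primePowerSum (Set.Icc a U) (weightM x c ε)| ≤
      2 * ε * x * Real.exp (2 * ε) * |nu c α| / Real.log (sieveB x c ε α) +
        Real.exp ε * mu c α * (4 * ε * √x + Real.log (Real.log (2 * x ^ 2))) := by
  have hα1 := (lt_one_of_one_lt_sieveB hα hB).le
  have haU : a ≤ U := Set.nonempty_Icc.1 (hI ▸ (Set.nonempty_Icc.2 hα1).image _)
  have hlow : ∀ t ∈ Set.Icc a U, x * Real.exp (-ε) ≤ t := by
    rw [hI]
    rintro _ ⟨u, hu, rfl⟩
    exact hδ ▸ mul_exp_neg_le_shell hx ⟨hα.le.trans hu.1, hu.2⟩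
  have ha := hlow a (Set.left_mem_Icc.2 haU)
  have h3 := three_lt_of_one_lt_sieveB hx hε hα hB
  have hweight : ∀ t ∈ Set.Icc a U, |weightM x c ε t| ≤ Real.exp ε * shellWeight c x δ t :=
    fun t ht => hδ ▸ abs_weightM_le_shellWeight hx (ne_zero_of_one_lt_sieveB hα hB)
      (abs_pos.1 (hδ ▸ eps_pos_of_one_lt_sieveB hx hα hB)) hα (by linarith [hlow t ht]) (hI ▸ ht)
  have hprimes := sum_primes_shellWeight_le_div_log hx hε hα hB hδ hI ha
  have hpowers := sum_properPrimePowers_shellWeight_le hx hε hα hB hδ hI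
  refine (abs_primePowerSum_le bddAbove_Icc hweight).trans ?_
  rw [primePowerSum_Icc (by linarith) haU]
  simp only [mul_left_comm _ (Real.exp ε), ← mul_sum, ← mul_add]
  refine (mul_le_mul_of_nonneg_left (add_le_add hprimes hpowers) (Real.exp_nonneg ε)).trans_eq ?_
  rw [show 2 * ε = ε + ε by ring, Real.exp_add]
  ring

end OuterIntervals

end LoganSieve

end

theorem proposition4_general {x ε c α : ℝ} (hx : 0 < x) (hε : ε ≤ 2 / 3) (hα : 0 < α)
    (hB : 1 < LoganSieve.sieveB x c ε α) :
    |LoganSieve.primePowerSum (LoganSieve.outerPlus x ε α) (LoganSieve.weightM x c ε)| ≤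
        2 * ε * x * Real.exp (2 * ε) * |LoganSieve.nu c α| / Real.log (LoganSieve.sieveB x c ε α) +
          Real.exp ε * LoganSieve.mu c α *
            (4.01 * ε * √x + Real.log (Real.log (2 * x ^ 2))) ∧
      |LoganSieve.primePowerSum (LoganSieve.outerMinus x ε α) (LoganSieve.weightM x c ε)| ≤
        2 * ε * x * Real.exp (2 * ε) * |LoganSieve.nu c α| / Real.log (LoganSieve.sieveB x c ε α) +
          Real.exp ε * LoganSieve.mu c α *
            (4.01 * ε * √x + Real.log (Real.log (2 * x ^ 2))) := by
  have hmu := LoganSieve.mu_pos_of_one_lt_sieveB hα hB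
  have hε0 := LoganSieve.eps_pos_of_one_lt_sieveB hx hα hB
  have hα1 := (LoganSieve.lt_one_of_one_lt_sieveB hα hB).le
  have hplus := LoganSieve.abs_primePowerSum_shell_le hx hε hα hB (abs_of_pos hε0)
    (LoganSieve.outerPlus_eq_image_shell hx hε0.le hα1)
  have hminus := LoganSieve.abs_primePowerSum_shell_le hx hε hα hB
    ((abs_neg ε).trans (abs_of_pos hε0)) (LoganSieve.outerMinus_eq_image_shell hx hε0.le hα1)
  refine ⟨hplus.trans ?_, hminus.trans ?_⟩ <;> gcongr <;> norm_num

theorem proposition4 (x ε c α : ℝ) (hx : 100 ≤ x) (hε : ε ≤ 0.01) (hc : 1 ≤ c)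
    (hα0 : 0 < α) (hα1 : α < 1) (hB : 1 < LoganSieve.sieveB x c ε α) :
    |LoganSieve.primePowerSum (LoganSieve.outerPlus x ε α) (LoganSieve.weightM x c ε)| ≤
        2 * ε * x * Real.exp (2 * ε) * |LoganSieve.nu c α| / Real.log (LoganSieve.sieveB x c ε α) +
          Real.exp ε * LoganSieve.mu c α *
            (4.01 * ε * √x + Real.log (Real.log (2 * x ^ 2))) ∧
      |LoganSieve.primePowerSum (LoganSieve.outerMinus x ε α) (LoganSieve.weightM x c ε)| ≤
        2 * ε * x * Real.exp (2 * ε) * |LoganSieve.nu c α| / Real.log (LoganSieve.sieveB x c ε α) +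
          Real.exp ε * LoganSieve.mu c α *
            (4.01 * ε * √x + Real.log (Real.log (2 * x ^ 2))) :=
  proposition4_general (by linarith) (hε.trans (by norm_num)) hα0 hB
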